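/- **Setting.** A network $(G,c)$ is a locally finite connected graph $G$ (self-loops allowed) with edge conductances $c:E(G)\to[0,\infty)$. Let $c_x=\sum_{y:\{x,y\}\in E(G)}c(\{x,y\})$. Let $d^G$ be the path metric of $G$, $B(x,r)=\{y\in V(G): d^G(x,y)\le r\}$, and $\bar B(x,r)=V(G)\setminus B(x,r)$. Let $\mathrm{vol}(x,r)=\sum_{y\in B(x,r)}c_y$, and let $\mathsf R_{\mathrm{eff}}(S\leftrightarrow T)$ be the effective resistance between disjoint $S,T\subseteq V(G)$, that is, the inverse of $\inf\{\sum_{\{x,y\}\in E(G)}c(\{x,y\})|g(x)-g(y)|^2 : g|_S\equiv0,\ g|_T\equiv1\}$ (with $1/0=\infty$). A random rooted network $(G,\rho)$, possibly with random edge marks $\xi$, is *reversible* if almost surely $c_\rho>0$, and if $(G,X_0,X_1,c,\xi)$ and $(G,X_1,X_0,c,\xi)$ have the same law as (isomorphism classes of) doubly rooted marked networks, where $X_0=\rho$ and $X_1$ is one step of the random walk with transition probabilities $c(\{x,y\})/c_x$. A random edge weight $\omega:E(G)\to[0,\infty)$, defined jointly with $(G,\rho)$, is *reversible* if $(G,\rho,\omega)$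 is reversible. Write $\mathrm{dist}_\omega$ for the $\omega$-weighted path distance; the distance to the empty set is $\infty$. An event depending on $R\in\mathbb N$ holds almost surely eventually if almost surely it holds for all but finitely many $R$. Let $\underline d_f$ be the supremum and $\overline d_f$ the infimum, in $[-\infty,\infty]$, of the real $d$ such that for every $\delta>0$, almost surely eventually, $\mathrm{vol}(\rho,R)\ge R^{d-\delta}$, respectively $\mathrm{vol}(\rho,R)\le R^{d+\delta}$. Let $\tilde\zeta\in[-\infty,\infty]$ be the supremum of the real $z$ such that for every $\delta>0$, almost surely eventually, $\mathsf R_{\mathrm{eff}}(B(\rho,R^{1-\delta})\leftrightarrow\bar B(\rho,R))\ge R^{z-\delta}$. Put $d_*=2\underline d_f-\overline d_f+\tilde\zeta$, read as $-\infty$ if $\overline d_f=\infty$. **Theorem.** Let $(G,\rho)$ be a reversible random network with $\mathbb E[1/c_\rho]<\infty$, such that almost surely the subnetwork $G_+$ formed by the vertices $x$ with $c_x>0$ and the edges of positive conductance is connected. Then for every $\delta>0$ and every real $s\le d_*-\delta$ (so $s=d_*-\delta$ if $d_*$ is finite, and every real $s$ if $d_*=\infty$) there is a reversible random edge weight $\omega:E(G)\to[0,\infty)$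 such that $\mathbb E[\omega(X_0,X_1)^2]<\infty$ and, almost surely eventually, $$\mathrm{dist}_\omega\bigl(\rho,\bar B(\rho,R)\bigr)\ \ge\ R^{s/2}.$$ -/

import Mathlib

open MeasureTheory Filter
open scoped ENNReal NNReal

namespace RevNet

/-- A locally finite, connected network with edge marks in `Ξ`.  Such a graph is countable, so its
vertices are labelled by natural numbers; labels carry no meaning, see `Iso`.
Edges are unordered pairs, and self-loops `s(x, x)` are allowed.
A conductance may vanish on an edge.  Values of `mark` off the edge set are irrelevant. -/
structure Network (Ξ : Type*) where
  verts : Set ℕ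
  edges : Set (Sym2 ℕ)
  cond : Sym2 ℕ → ℝ≥0
  mark : Sym2 ℕ → Ξ
  mem_of_edge : ∀ x y, s(x, y) ∈ edges → x ∈ verts
  cond_eq_zero : ∀ e, e ∉ edges → cond e = 0
  locallyFinite : ∀ x, {y | s(x, y) ∈ edges}.Finite
  connected : ∀ x ∈ verts, ∀ y ∈ verts, (SimpleGraph.fromEdgeSet edges).Reachable x y

/-- A network with a distinguished vertex. -/
structure RootedNetwork (Ξ : Type*) extends Network Ξ where
  root : ℕ
  root_mem : root ∈ verts

section Measurability

variable {Ξ : Type*} [MeasurableSpace Ξ]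

/-- The product σ-algebra on labelled networks. -/
instance : MeasurableSpace (Network Ξ) :=
  MeasurableSpace.comap (fun N => (N.verts, N.edges, N.cond, N.mark)) inferInstance

instance : MeasurableSpace (RootedNetwork Ξ) :=
  MeasurableSpace.comap (fun N => (N.toNetwork, N.root)) inferInstance

end Measurability

section Geometry

variable {Ξ : Type*}

namespace Network

/-- The underlying graph, self-loops removed (they play no role for distances). -/
def graph (N : Network Ξ) : SimpleGraph ℕ := SimpleGraph.fromEdgeSet N.edges

/-- The closed ball `B(x, r)` in the path metric of the graph. -/
def ball (N : Network Ξ) (x : ℕ) (r : ℝ) : Set ℕ := {y ∈ N.verts | (N.graph.dist x y : ℝ) ≤ r}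

/-- The complement of `B(x, r)` in the vertex set. -/
def ballCompl (N : Network Ξ) (x : ℕ) (r : ℝ) : Set ℕ := N.verts \ N.ball x r

/-- `c_x`, the total conductance at `x` (a self-loop counts once). -/
noncomputable def condAt (N : Network Ξ) (x : ℕ) : ℝ≥0∞ := ∑' y, (N.cond s(x, y) : ℝ≥0∞)

/-- Transition probabilities of the random walk. -/
noncomputable def trans (N : Network Ξ) (x y : ℕ) : ℝ≥0∞ := (N.cond s(x, y) : ℝ≥0∞) / N.condAt x

/-- `vol(x, r)`, the sum of `c_y` over the ball `B(x, r)`. -/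
noncomputable def vol (N : Network Ξ) (x : ℕ) (r : ℝ) : ℝ≥0∞ := ∑' y : N.ball x r, N.condAt y

/-- `|g(x) - g(y)|` for `e = {x, y}`. -/
noncomputable def edgeDiff (g : ℕ → ℝ) : Sym2 ℕ → ℝ≥0 :=
  Sym2.lift ⟨fun x y => nndist (g x) (g y), fun _ _ => nndist_comm _ _⟩

/-- The Dirichlet energy, a sum over unoriented edges. -/
noncomputable def energy (N : Network Ξ) (g : ℕ → ℝ) : ℝ≥0∞ :=
  ∑' e : Sym2 ℕ, (N.cond e : ℝ≥0∞) * (edgeDiff g e : ℝ≥0∞) ^ 2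

/-- The effective resistance between two disjoint vertex sets: the inverse of the least Dirichlet
energy of a function equal to `0` on `S` and to `1` on `T`.  It is `∞` when no current can flow. -/
noncomputable def effRes (N : Network Ξ) (S T : Set ℕ) : ℝ≥0∞ :=
  (⨅ (g : ℕ → ℝ) (_ : ∀ x ∈ S, g x = 0) (_ : ∀ x ∈ T, g x = 1), N.energy g)⁻¹

/-- The subnetwork of edges with positive conductance, on the vertices `x` with `c_x > 0`,
is connected. -/
def PosConnected (N : Network Ξ) : Prop :=
  ∀ x y, 0 < N.condAt x → 0 < N.condAt y →
    (SimpleGraph.fromEdgeSet {e | 0 < N.cond e}).Reachable x y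

/-- The weighted path (pseudo)distance, the weights being the edge marks, from `x` to a set `T`;
it is `∞` when `T` is empty. -/
noncomputable def weightDist (N : Network ℝ≥0) (x : ℕ) (T : Set ℕ) : ℝ≥0∞ :=
  ⨅ (y : ℕ) (_ : y ∈ T) (p : N.graph.Walk x y), ((p.edges.map N.mark).sum : ℝ≥0∞)

/-- Isomorphisms of marked networks. -/
structure Iso (N N' : Network Ξ) where
  toEquiv : N.verts ≃ N'.verts
  edge_iff : ∀ x y : N.verts,
    s((x : ℕ), (y : ℕ)) ∈ N.edges ↔ s((toEquiv x : ℕ), (toEquiv y : ℕ)) ∈ N'.edges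
  cond_eq : ∀ x y : N.verts, s((x : ℕ), (y : ℕ)) ∈ N.edges →
    N.cond s((x : ℕ), (y : ℕ)) = N'.cond s((toEquiv x : ℕ), (toEquiv y : ℕ))
  mark_eq : ∀ x y : N.verts, s((x : ℕ), (y : ℕ)) ∈ N.edges →
    N.mark s((x : ℕ), (y : ℕ)) = N'.mark s((toEquiv x : ℕ), (toEquiv y : ℕ))

end Network

/-- A set of doubly rooted networks that depends only on isomorphism classes. -/
def IsInvariant (A : Set (Network Ξ × ℕ × ℕ)) : Prop :=
  ∀ (N N' : Network Ξ) (φ : N.Iso N') (x y : N.verts),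
    (N, (x : ℕ), (y : ℕ)) ∈ A ↔ (N', (φ.toEquiv x : ℕ), (φ.toEquiv y : ℕ)) ∈ A

/-- Forget the marks. -/
def RootedNetwork.forget (N : RootedNetwork Ξ) : RootedNetwork Unit where
  verts := N.verts
  edges := N.edges
  cond := N.cond
  mark := fun _ => ()
  mem_of_edge := N.mem_of_edge
  cond_eq_zero := N.cond_eq_zero
  locallyFinite := N.locallyFinite
  connected := N.connected
  root := N.root
  root_mem := N.root_mem

end Geometry

section Random

variable {Ξ : Type*} [MeasurableSpace Ξ]

/-- The law of `(G, X₀, X₁)` where `(G, X₀)` has law `μ` and `X₁` is one step of the random walk. -/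
noncomputable def stepLaw (μ : Measure (RootedNetwork Ξ)) : Measure (Network Ξ × ℕ × ℕ) :=
  Measure.sum fun v : ℕ =>
    (μ.withDensity fun N => N.trans N.root v).map fun N => (N.toNetwork, N.root, v)

/-- `μ` is the law of a reversible random network: almost surely `c_ρ > 0`, and
`(G, X₀, X₁)` and `(G, X₁, X₀)`, taken up to isomorphism, have the same law. -/
structure IsReversible (μ : Measure (RootedNetwork Ξ)) : Prop where
  condAt_root_pos : ∀ᵐ N ∂μ, 0 < N.condAt N.root
  step_symm : ∀ A : Set (Network Ξ × ℕ × ℕ), MeasurableSet A → IsInvariant A →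
    stepLaw μ A = stepLaw μ {q | (q.1, q.2.2, q.2.1) ∈ A}

/-- The lower volume growth exponent. -/
noncomputable def lowerVolExp (μ : Measure (RootedNetwork Ξ)) : EReal :=
  sSup {a : EReal | ∃ d : ℝ, a = d ∧ ∀ δ : ℝ, 0 < δ → ∀ᵐ N ∂μ, ∀ᶠ R : ℕ in atTop,
    ENNReal.ofReal ((R : ℝ) ^ (d - δ)) ≤ N.vol N.root R}

/-- The upper volume growth exponent. -/
noncomputable def upperVolExp (μ : Measure (RootedNetwork Ξ)) : EReal :=
  sInf {a : EReal | ∃ d : ℝ, a = d ∧ ∀ δ : ℝ, 0 < δ → ∀ᵐ N ∂μ, ∀ᶠ R : ℕ in atTop,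
    N.vol N.root R ≤ ENNReal.ofReal ((R : ℝ) ^ (d + δ))}

/-- The resistance exponent. -/
noncomputable def resExp (μ : Measure (RootedNetwork Ξ)) : EReal :=
  sSup {a : EReal | ∃ z : ℝ, a = z ∧ ∀ δ : ℝ, 0 < δ → ∀ᵐ N ∂μ, ∀ᶠ R : ℕ in atTop,
    ENNReal.ofReal ((R : ℝ) ^ (z - δ)) ≤
      N.effRes (N.ball N.root ((R : ℝ) ^ (1 - δ))) (N.ballCompl N.root R)}

/-- Twice the lower volume exponent minus the upper one plus the resistance exponent.  With the
conventions of `EReal` this is `⊥` when the upper volume exponent is `⊤`. -/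
noncomputable def dStar (μ : Measure (RootedNetwork Ξ)) : EReal :=
  2 * lowerVolExp μ - upperVolExp μ + resExp μ

end Random

end RevNet

/-! Fix a radius R = 2^n and let a, b, z stand for the lower volume, upper volume and resistance
exponents. A typical vertex x has an equilibrium potential, equal to 0 near x and to 1 off B(x,R),
of energy about R^(-z). Averaging the absolute differences of these potentials over all good centres
x gives an isomorphism-invariant pseudometric (`Network.scaleDist`). The intensity of a centre is
the inverse of the good volume in its ball of radius 2r, so that every ball of radius r carries
total mass at most 1 (`Network.tsum_intensity_le_one`). Hence the mean intensity at the root is at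
most about R^(-a). Cauchy-Schwarz over the centres costs a volume ratio R^(b-a), and the mass
transport principle (`IsReversible.mass_transport`) moves the root from an edge to the centre of a
potential. So the mean square length of a random edge is at most about R^(b-a) R^(-z) R^(-a) =
R^(-(2a-b+z)) (`IsReversible.lintegral_sq_scaleDist_le`).

In the other direction, a good root has distance at least goodVol(2r)/goodVol(4r) from the
complement of B(ρ,2R). This ratio may be small for a given r, but volumes grow polynomially and
there are of order n dyadic radii r available, so for one of them it is at least a constant
(`Network.Good.exists_inv_le_scaleDist`). All these radii are included, at the price of a factor n.
Since s < d_*, each scale can be stretched by slightly more than R^(s/2) with bounded second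
moments, and a geometrically weighted sum over scales (`Network.multiDist`) is the required
pseudometric.

It becomes an edge weight through the lengths D(v,w) on edges of positive conductance. Edges of zero
conductance are never crossed by the walk, so they may receive any finite lengths; these are chosen
large enough that they give no shortcut (`Network.le_weightDist_attach`).

All constructions must be measurable and independent of vertex labels; `Natural` records both
properties and is closed under the operations used. -/

namespace RevNet

/-! ### Measurable, isomorphism-invariant functions of networks -/

section Natural

variable {Ξ : Type*} [MeasurableSpace Ξ]

/-- Put a vertex in front of a sequence of vertices. -/
def push (y : ℕ) (e : ℕ → ℕ) : ℕ → ℕ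
  | 0 => y
  | n + 1 => e n

/-- A function of a network and a sequence of its vertices which is measurable and depends only on
the isomorphism class. -/
structure Natural (F : Network Ξ → (ℕ → ℕ) → ℝ≥0∞) : Prop where
  meas : ∀ e, Measurable fun N => F N e
  inv : ∀ (N N' : Network Ξ) (φ : N.Iso N') (e : ℕ → N.verts),
    F N (fun i => e i) = F N' (fun i => φ.toEquiv (e i))

/-- The analogue of `Natural` for predicates. -/
structure NaturalProp (P : Network Ξ → (ℕ → ℕ) → Prop) : Prop where
  meas : ∀ e, MeasurableSet {N | P N e}
  inv : ∀ (N N' : Network Ξ) (φ : N.Iso N') (e : ℕ → N.verts),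
    P N (fun i => e i) ↔ P N' (fun i => φ.toEquiv (e i))

/-- `Natural` functions of one vertex. -/
def Natural1 (G : Network Ξ → ℕ → ℝ≥0∞) : Prop := Natural fun N e => G N (e 0)

/-- `Natural` functions of two vertices. -/
def Natural2 (G : Network Ξ → ℕ → ℕ → ℝ≥0∞) : Prop := Natural fun N e => G N (e 0) (e 1)

/-- `Natural` predicates on one vertex. -/
def NaturalProp1 (P : Network Ξ → ℕ → Prop) : Prop := NaturalProp fun N e => P N (e 0)

/-- `Natural` predicates on two vertices. -/
def NaturalProp2 (P : Network Ξ → ℕ → ℕ → Prop) : Prop := NaturalProp fun N e => P N (e 0) (e 1)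

variable {F G : Network Ξ → (ℕ → ℕ) → ℝ≥0∞} {P Q : Network Ξ → (ℕ → ℕ) → Prop}

lemma Natural.subst (hF : Natural F) (σ : ℕ → ℕ) : Natural fun N e => F N (fun i => e (σ i)) :=
  ⟨fun _ => hF.meas _, fun N N' φ e => hF.inv N N' φ fun i => e (σ i)⟩

lemma NaturalProp.subst (hP : NaturalProp P) (σ : ℕ → ℕ) :
    NaturalProp fun N e => P N (fun i => e (σ i)) :=
  ⟨fun _ => hP.meas _, fun N N' φ e => hP.inv N N' φ fun i => e (σ i)⟩

lemma Natural1.app {G : Network Ξ → ℕ → ℝ≥0∞} (h : Natural1 G) (i : ℕ) :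
    Natural fun N e => G N (e i) := Natural.subst h fun _ => i

lemma Natural2.app {G : Network Ξ → ℕ → ℕ → ℝ≥0∞} (h : Natural2 G) (i j : ℕ) :
    Natural fun N e => G N (e i) (e j) := Natural.subst h (push i fun _ => j)

lemma NaturalProp1.app {P : Network Ξ → ℕ → Prop} (h : NaturalProp1 P) (i : ℕ) :
    NaturalProp fun N e => P N (e i) := NaturalProp.subst h fun _ => i

lemma NaturalProp2.app {P : Network Ξ → ℕ → ℕ → Prop} (h : NaturalProp2 P) (i j : ℕ) :
    NaturalProp fun N e => P N (e i) (e j) := NaturalProp.subst h (push i fun _ => j)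

lemma Natural.const (c : ℝ≥0∞) : Natural fun (_ : Network Ξ) _ => c :=
  ⟨fun _ => measurable_const, fun _ _ _ _ => rfl⟩

lemma Natural.add (hF : Natural F) (hG : Natural G) : Natural fun N e => F N e + G N e :=
  ⟨fun e => (hF.meas e).add (hG.meas e), fun N N' φ e => by rw [hF.inv N N' φ, hG.inv N N' φ]⟩

lemma Natural.mul (hF : Natural F) (hG : Natural G) : Natural fun N e => F N e * G N e :=
  ⟨fun e => (hF.meas e).mul (hG.meas e), fun N N' φ e => by rw [hF.inv N N' φ, hG.inv N N' φ]⟩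

lemma Natural.div (hF : Natural F) (hG : Natural G) : Natural fun N e => F N e / G N e :=
  ⟨fun e => (hF.meas e).div (hG.meas e), fun N N' φ e => by rw [hF.inv N N' φ, hG.inv N N' φ]⟩

lemma Natural.sub (hF : Natural F) (hG : Natural G) : Natural fun N e => F N e - G N e :=
  ⟨fun e => (hF.meas e).sub (hG.meas e), fun N N' φ e => by rw [hF.inv N N' φ, hG.inv N N' φ]⟩

lemma Natural.pow (hF : Natural F) (n : ℕ) : Natural fun N e => F N e ^ n :=
  ⟨fun e => (hF.meas e).pow_const n, fun N N' φ e => by rw [hF.inv N N' φ]⟩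

lemma Natural.iSup {ι : Type*} [Countable ι] {H : ι → Network Ξ → (ℕ → ℕ) → ℝ≥0∞}
    (h : ∀ i, Natural (H i)) : Natural fun N e => ⨆ i, H i N e :=
  ⟨fun e => Measurable.iSup fun i => (h i).meas e,
    fun N N' φ e => iSup_congr fun i => (h i).inv N N' φ e⟩

lemma Natural.iInf {ι : Type*} [Countable ι] {H : ι → Network Ξ → (ℕ → ℕ) → ℝ≥0∞}
    (h : ∀ i, Natural (H i)) : Natural fun N e => ⨅ i, H i N e :=
  ⟨fun e => Measurable.iInf fun i => (h i).meas e,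
    fun N N' φ e => iInf_congr fun i => (h i).inv N N' φ e⟩

lemma Natural.tsum {ι : Type*} [Countable ι] {H : ι → Network Ξ → (ℕ → ℕ) → ℝ≥0∞}
    (h : ∀ i, Natural (H i)) : Natural fun N e => ∑' i, H i N e :=
  ⟨fun e => Measurable.tsum fun i => (h i).meas e,
    fun N N' φ e => tsum_congr fun i => (h i).inv N N' φ e⟩

/-- Summation over a vertex. -/
lemma Natural.tsum_vertex (hF : Natural F)
    (h0 : ∀ N y e, y ∉ N.verts → F N (push y e) = 0) :
    Natural fun N e => ∑' y, F N (push y e) := by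
  refine ⟨fun e => Measurable.tsum fun y => hF.meas _, fun N N' φ e => ?_⟩
  -- Labels that are not vertices contribute nothing, so the sum may be taken over the vertex type,
  -- on which the isomorphism is a bijection.
  have key : ∀ (N : Network Ξ) (e : ℕ → ℕ),
      ∑' y, F N (push y e) = ∑' y : N.verts, F N (push y e) := fun N e =>
    (tsum_subtype_eq_of_support_subset (f := fun y => F N (push y e)) fun y hy => by
      by_contra h
      exact hy (h0 N y e h)).symm
  rw [key, key, ← φ.toEquiv.tsum_eq]
  refine tsum_congr fun y => ?_
  have h1 : (fun i => ((Nat.casesOn i y e : N.verts) : ℕ)) = push y fun i => e i := by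
    ext i; cases i <;> rfl
  have h2 : (fun i => ((φ.toEquiv (Nat.casesOn i y e : N.verts)) : ℕ))
      = push (φ.toEquiv y) fun i => φ.toEquiv (e i) := by
    ext i; cases i <;> rfl
  have := hF.inv N N' φ (fun i => Nat.casesOn i y e)
  rwa [h1, h2] at this

open Classical in
lemma Natural.ite (hP : NaturalProp P) (hF : Natural F) (hG : Natural G) :
    Natural fun N e => if P N e then F N e else G N e :=
  ⟨fun e => Measurable.ite (hP.meas e) (hF.meas e) (hG.meas e),
    fun N N' φ e => by simp only [hP.inv N N' φ, hF.inv N N' φ, hG.inv N N' φ]⟩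

lemma NaturalProp.and (hP : NaturalProp P) (hQ : NaturalProp Q) :
    NaturalProp fun N e => P N e ∧ Q N e :=
  ⟨fun e => (hP.meas e).inter (hQ.meas e),
    fun N N' φ e => by rw [hP.inv N N' φ, hQ.inv N N' φ]⟩

lemma NaturalProp.not (hP : NaturalProp P) : NaturalProp fun N e => ¬ P N e :=
  ⟨fun e => (hP.meas e).compl, fun N N' φ e => by rw [hP.inv N N' φ]⟩

lemma NaturalProp.le (hF : Natural F) (hG : Natural G) : NaturalProp fun N e => F N e ≤ G N e :=
  ⟨fun e => measurableSet_le (hF.meas e) (hG.meas e),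
    fun N N' φ e => by rw [hF.inv N N' φ, hG.inv N N' φ]⟩

lemma NaturalProp.lt (hF : Natural F) (hG : Natural G) : NaturalProp fun N e => F N e < G N e :=
  ⟨fun e => measurableSet_lt (hF.meas e) (hG.meas e),
    fun N N' φ e => by rw [hF.inv N N' φ, hG.inv N N' φ]⟩

lemma NaturalProp.eq_vertex (i j : ℕ) : NaturalProp fun (_ : Network Ξ) e => e i = e j :=
  ⟨fun _ => MeasurableSet.const _, fun N N' φ e => by
    rw [Subtype.val_inj, Subtype.val_inj, φ.toEquiv.injective.eq_iff]⟩

lemma measurable_network_data :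
    Measurable fun N : Network Ξ => (N.verts, N.edges, N.cond, N.mark) :=
  comap_measurable _

lemma measurable_cond (e : Sym2 ℕ) : Measurable fun N : Network Ξ => N.cond e :=
  (measurable_pi_apply e).comp
    (measurable_fst.comp (measurable_snd.comp (measurable_snd.comp measurable_network_data)))

lemma measurable_mark (e : Sym2 ℕ) : Measurable fun N : Network Ξ => N.mark e :=
  (measurable_pi_apply e).comp
    (measurable_snd.comp (measurable_snd.comp (measurable_snd.comp measurable_network_data)))

lemma measurableSet_mem_verts (x : ℕ) : MeasurableSet {N : Network Ξ | x ∈ N.verts} :=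
  measurableSet_setOfPred.2 ((measurable_set_mem x).comp (measurable_fst.comp measurable_network_data))

lemma measurableSet_mem_edges (e : Sym2 ℕ) : MeasurableSet {N : Network Ξ | e ∈ N.edges} :=
  measurableSet_setOfPred.2 ((measurable_set_mem e).comp
    (measurable_fst.comp (measurable_snd.comp measurable_network_data)))

lemma NaturalProp.edge (i j : ℕ) :
    NaturalProp fun (N : Network Ξ) e => s(e i, e j) ∈ N.edges :=
  ⟨fun e => measurableSet_mem_edges s(e i, e j), fun _ _ φ e => φ.edge_iff (e i) (e j)⟩

lemma NaturalProp.vert (i : ℕ) : NaturalProp fun (N : Network Ξ) e => e i ∈ N.verts :=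
  ⟨fun e => measurableSet_mem_verts (e i), fun _ _ φ e => by simp⟩

lemma Natural.cond (i j : ℕ) :
    Natural fun (N : Network Ξ) e => (N.cond s(e i, e j) : ℝ≥0∞) :=
  ⟨fun e => (measurable_cond s(e i, e j)).coe_nnreal_ennreal, fun N N' φ e => by
    by_cases h : s((e i : ℕ), (e j : ℕ)) ∈ N.edges
    · rw [φ.cond_eq _ _ h]
    · rw [N.cond_eq_zero _ h, N'.cond_eq_zero _ (by rwa [← φ.edge_iff])]⟩

lemma Natural2.inv' {G : Network Ξ → ℕ → ℕ → ℝ≥0∞} (h : Natural2 G) (N N' : Network Ξ)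
    (φ : N.Iso N') (x y : N.verts) : G N x y = G N' (φ.toEquiv x) (φ.toEquiv y) :=
  Natural.inv h N N' φ (fun i => Nat.casesOn i x fun _ => y)

lemma Natural2.meas' {G : Network Ξ → ℕ → ℕ → ℝ≥0∞} (h : Natural2 G) (x y : ℕ) :
    Measurable fun N => G N x y :=
  Natural.meas h (push x fun _ => y)

lemma Natural1.meas' {G : Network Ξ → ℕ → ℝ≥0∞} (h : Natural1 G) (x : ℕ) :
    Measurable fun N => G N x :=
  Natural.meas h (fun _ => x)

end Natural

/-! ### Conductances, distances and balls -/

section Basic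

variable {Ξ : Type*}

namespace Network

lemma mem_right_of_edge (N : Network Ξ) {x y : ℕ} (h : s(x, y) ∈ N.edges) : y ∈ N.verts :=
  N.mem_of_edge y x (by rwa [Sym2.eq_swap])

lemma edge_of_cond_ne_zero (N : Network Ξ) {e : Sym2 ℕ} (h : N.cond e ≠ 0) : e ∈ N.edges := by
  by_contra h'
  exact h (N.cond_eq_zero _ h')

lemma mem_left_of_cond (N : Network Ξ) {x y : ℕ} (h : N.cond s(x, y) ≠ 0) : x ∈ N.verts :=
  N.mem_of_edge x y (N.edge_of_cond_ne_zero h)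

lemma mem_right_of_cond (N : Network Ξ) {x y : ℕ} (h : N.cond s(x, y) ≠ 0) : y ∈ N.verts :=
  N.mem_right_of_edge (N.edge_of_cond_ne_zero h)

lemma condAt_eq_zero_of_notMem (N : Network Ξ) {x : ℕ} (h : x ∉ N.verts) : N.condAt x = 0 := by
  refine ENNReal.tsum_eq_zero.2 fun y => ?_
  by_contra h'
  exact h (N.mem_left_of_cond (y := y) (by simpa using h'))

lemma mem_verts_of_condAt (N : Network Ξ) {x : ℕ} (h : N.condAt x ≠ 0) : x ∈ N.verts := by
  by_contra h'
  exact h (N.condAt_eq_zero_of_notMem h')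

lemma condAt_ne_top (N : Network Ξ) (x : ℕ) : N.condAt x ≠ ∞ := by
  have : N.condAt x = ∑ y ∈ (N.locallyFinite x).toFinset, (N.cond s(x, y) : ℝ≥0∞) :=
    tsum_eq_sum fun y hy => by
      simp only [Set.Finite.mem_toFinset, Set.mem_ofPred_eq] at hy
      simp [N.cond_eq_zero _ hy]
  rw [this]
  exact ENNReal.sum_ne_top.2 fun _ _ => ENNReal.coe_ne_top

lemma cond_le_condAt (N : Network Ξ) (x y : ℕ) : (N.cond s(x, y) : ℝ≥0∞) ≤ N.condAt x :=
  ENNReal.le_tsum y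

lemma cond_le_condAt_right (N : Network Ξ) (x y : ℕ) : (N.cond s(x, y) : ℝ≥0∞) ≤ N.condAt y := by
  rw [Sym2.eq_swap]
  exact N.cond_le_condAt y x

lemma condAt_mul_trans (N : Network Ξ) (x y : ℕ) :
    N.condAt x * N.trans x y = N.cond s(x, y) := by
  rw [trans, mul_comm]
  by_cases h : N.condAt x = 0
  · have := N.cond_le_condAt x y
    rw [h] at this ⊢
    simpa using this.antisymm' zero_le
  · exact ENNReal.div_mul_cancel h (N.condAt_ne_top x)

lemma trans_eq_zero_of_notMem (N : Network Ξ) {x y : ℕ} (h : y ∉ N.verts) :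
    N.trans x y = 0 := by
  have : N.cond s(x, y) = 0 := by
    by_contra h'
    exact h (N.mem_right_of_cond h')
  simp [trans, this]

lemma tsum_trans (N : Network Ξ) {x : ℕ} (h : N.condAt x ≠ 0) : ∑' y, N.trans x y = 1 := by
  simp only [trans, div_eq_mul_inv, ENNReal.tsum_mul_right]
  exact ENNReal.mul_inv_cancel h (N.condAt_ne_top x)

lemma tsum_trans_le (N : Network Ξ) (x : ℕ) : ∑' y, N.trans x y ≤ 1 := by
  by_cases h : N.condAt x = 0
  · have : ∀ y, N.trans x y = 0 := fun y => by
      have := N.cond_le_condAt x y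
      rw [h, nonpos_iff_eq_zero] at this
      simp [trans, this]
    simp [this]
  · exact (N.tsum_trans h).le

/-- Both `x` and `y` are vertices, at distance at most `k`. -/
def Near (N : Network Ξ) (k x y : ℕ) : Prop :=
  x ∈ N.verts ∧ y ∈ N.verts ∧ N.graph.dist x y ≤ k

variable {N : Network Ξ} {k l x y z : ℕ}

lemma Near.symm (h : N.Near k x y) : N.Near k y x :=
  ⟨h.2.1, h.1, by rw [SimpleGraph.dist_comm]; exact h.2.2⟩

lemma Near.mono (h : N.Near k x y) (hkl : k ≤ l) : N.Near l x y :=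
  ⟨h.1, h.2.1, h.2.2.trans hkl⟩

lemma Near.refl (k : ℕ) (hx : x ∈ N.verts) : N.Near k x x := ⟨hx, hx, by simp⟩

lemma dist_triangle (hx : x ∈ N.verts) (hy : y ∈ N.verts) (hz : z ∈ N.verts) :
    N.graph.dist x z ≤ N.graph.dist x y + N.graph.dist y z := by
  obtain ⟨p, hp⟩ := (N.connected x hx y hy).exists_walk_length_eq_dist
  obtain ⟨q, hq⟩ := (N.connected y hy z hz).exists_walk_length_eq_dist
  have := SimpleGraph.dist_le (p.append q)
  rw [SimpleGraph.Walk.length_append] at this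
  simp only [graph]
  omega

lemma Near.trans (h : N.Near k x y) (h' : N.Near l y z) : N.Near (k + l) x z :=
  ⟨h.1, h'.2.1, (dist_triangle h.1 h.2.1 h'.2.1).trans (add_le_add h.2.2 h'.2.2)⟩

lemma near_one_of_edge (h : s(x, y) ∈ N.edges) : N.Near 1 x y := by
  refine ⟨N.mem_of_edge _ _ h, N.mem_right_of_edge h, ?_⟩
  by_cases hxy : x = y
  · simp [hxy]
  · have : N.graph.Adj x y := by simp [graph, h, hxy]
    exact (SimpleGraph.dist_eq_one_iff_adj.2 this).le

lemma near_zero : N.Near 0 x y ↔ x ∈ N.verts ∧ x = y := by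
  constructor
  · rintro ⟨hx, hy, h⟩
    exact ⟨hx, ((N.connected x hx y hy).dist_eq_zero_iff).1 (Nat.le_zero.1 h)⟩
  · rintro ⟨hx, rfl⟩
    exact Near.refl 0 hx

/-- Growing balls one edge at a time gives a recursion from which finiteness and measurability of
balls follow by induction. -/
lemma near_succ : N.Near (k + 1) x y ↔ N.Near k x y ∨ ∃ w, N.Near k x w ∧ s(w, y) ∈ N.edges := by
  constructor
  · rintro ⟨hx, hy, h⟩
    by_cases hk : N.graph.dist x y ≤ k
    · exact Or.inl ⟨hx, hy, hk⟩
    · obtain ⟨p, hp⟩ := (N.connected y hy x hx).exists_walk_length_eq_dist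
      rw [SimpleGraph.dist_comm] at h hk
      cases p with
      | nil => simp at hk
      | @cons _ w _ hw q =>
        have hwe : s(y, w) ∈ N.edges := by
          rw [SimpleGraph.fromEdgeSet_adj] at hw
          exact hw.1
        refine Or.inr ⟨w, ⟨hx, N.mem_right_of_edge hwe, ?_⟩, by rwa [Sym2.eq_swap]⟩
        rw [SimpleGraph.dist_comm]
        have := SimpleGraph.dist_le q
        simp only [SimpleGraph.Walk.length_cons] at hp
        simp only [graph] at h hk ⊢
        omega
  · rintro (h | ⟨w, h, hw⟩)
    · exact h.mono (Nat.le_succ k)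
    · exact h.trans (near_one_of_edge hw)

lemma finite_near (N : Network Ξ) (k x : ℕ) : {y | N.Near k x y}.Finite := by
  induction k with
  | zero => exact (Set.finite_singleton x).subset fun y hy => (near_zero.1 hy).2.symm
  | succ k ih =>
    refine (ih.union (ih.biUnion fun w _ => N.locallyFinite w)).subset fun y hy => ?_
    rcases near_succ.1 hy with h | ⟨w, h, hw⟩
    · exact Or.inl h
    · exact Or.inr (Set.mem_biUnion h hw)

lemma mem_ball_iff (hx : x ∈ N.verts) {r : ℝ} (hr : 0 ≤ r) :
    y ∈ N.ball x r ↔ N.Near ⌊r⌋₊ x y := by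
  simp only [ball, Set.mem_ofPred_eq, Near, hx, true_and, Nat.le_floor_iff hr]

/-- The volume of a ball of integer radius. -/
noncomputable def nvol (N : Network Ξ) (k x : ℕ) : ℝ≥0∞ :=
  open Classical in ∑' y, if N.Near k x y then N.condAt y else 0

lemma vol_eq_nvol (hx : x ∈ N.verts) {r : ℝ} (hr : 0 ≤ r) : N.vol x r = N.nvol ⌊r⌋₊ x := by
  classical
  rw [vol, tsum_subtype (N.ball x r) N.condAt, nvol]
  refine tsum_congr fun y => ?_
  simp only [Set.indicator_apply, mem_ball_iff hx hr]

lemma nvol_mono (N : Network Ξ) (x : ℕ) (h : k ≤ l) : N.nvol k x ≤ N.nvol l x := by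
  classical
  refine ENNReal.tsum_le_tsum fun y => ?_
  split_ifs with h1 h2
  · exact le_rfl
  · exact absurd (h1.mono h) h2
  · exact zero_le
  · exact le_rfl

end Network

end Basic

/-! ### Naturality of balls and volumes -/

section NaturalBasic

variable {Ξ : Type*} [MeasurableSpace Ξ]

lemma natural_condAt : Natural1 (Network.condAt (Ξ := Ξ)) :=
  Natural.tsum_vertex (Natural.cond 1 0) fun N y e hy => by
    by_contra h
    exact hy (N.mem_right_of_cond (x := e 0) (y := y) fun h' => h (by simp [push, h']))

lemma natural_trans : Natural2 (Network.trans (Ξ := Ξ)) :=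
  (Natural.cond 0 1).div (natural_condAt.app 0)

-- The existential over w in `Network.near_succ` is encoded as positivity of a sum of indicators
-- over vertices, to which `Natural.tsum_vertex` applies.
open Classical in
lemma natural_near (k : ℕ) : NaturalProp2 fun (N : Network Ξ) x y => N.Near k x y := by
  induction k with
  | zero =>
    simp only [NaturalProp2, Network.near_zero]
    exact (NaturalProp.vert 0).and (NaturalProp.eq_vertex 0 1)
  | succ k ih =>
    have h : NaturalProp fun (N : Network Ξ) e => 0 < ∑' w,
        if N.Near k (e 0) w then (if s(w, e 1) ∈ N.edges then (1 : ℝ≥0∞) else 0) else 0 :=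
      NaturalProp.lt (Natural.const 0) (Natural.tsum_vertex
        (Natural.ite (ih.app 1 0) (Natural.ite (NaturalProp.edge 0 2) (Natural.const 1)
          (Natural.const 0)) (Natural.const 0))
        fun N y e hy => if_neg fun h => hy h.2.1)
    have h2 : ∀ (N : Network Ξ) (e : ℕ → ℕ), N.Near (k + 1) (e 0) (e 1) ↔
        ¬ (¬ N.Near k (e 0) (e 1) ∧ ¬ 0 < ∑' w,
          if N.Near k (e 0) w then (if s(w, e 1) ∈ N.edges then (1 : ℝ≥0∞) else 0) else 0) := by
      intro N e
      rw [Network.near_succ, not_and_or, not_not, not_not, pos_iff_ne_zero, Ne,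
        ENNReal.tsum_eq_zero]
      simp
    simp only [NaturalProp2, h2]
    exact ((ih.app 0 1).not.and h.not).not

lemma natural_nvol (k : ℕ) : Natural1 fun (N : Network Ξ) x => N.nvol k x := by
  classical
  exact Natural.tsum_vertex (Natural.ite ((natural_near k).app 1 0) (natural_condAt.app 0)
    (Natural.const 0)) fun N y e hy => if_neg fun h => hy h.2.1

end NaturalBasic

/-! ### Iterated transition kernels and detailed balance -/

section Kernel

variable {Ξ : Type*}

namespace Network

/-- The `k`-step transition probabilities. -/
noncomputable def transIter (N : Network Ξ) : ℕ → ℕ → ℕ → ℝ≥0∞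
  -- The vertex test makes the kernel vanish at labels that are not vertices, as vertex sums
  -- require.
  | 0, x, y => open Classical in if x ∈ N.verts then (if x = y then 1 else 0) else 0
  | k + 1, x, y => ∑' w, N.trans x w * N.transIter k w y

variable (N : Network Ξ)

lemma transIter_succ (k x y : ℕ) :
    N.transIter (k + 1) x y = ∑' w, N.trans x w * N.transIter k w y := rfl

lemma transIter_zero_self {x : ℕ} (hx : x ∈ N.verts) : N.transIter 0 x x = 1 := by
  simp [transIter, hx]

lemma transIter_zero_ne {x y : ℕ} (h : x ≠ y) : N.transIter 0 x y = 0 := by simp [transIter, h]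

lemma transIter_succ' (k x y : ℕ) :
    N.transIter (k + 1) x y = ∑' w, N.transIter k x w * N.trans w y := by
  induction k generalizing x y with
  | zero =>
    rw [transIter_succ, tsum_eq_single y fun w hw => by rw [N.transIter_zero_ne hw, mul_zero],
      tsum_eq_single x fun w hw => by rw [N.transIter_zero_ne hw.symm, zero_mul]]
    by_cases hx : x ∈ N.verts
    · by_cases hy : y ∈ N.verts
      · rw [N.transIter_zero_self hx, N.transIter_zero_self hy, one_mul, mul_one]
      · rw [N.trans_eq_zero_of_notMem hy, zero_mul, mul_zero]
    · have : N.trans x y = 0 := by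
        rw [trans, ENNReal.div_eq_zero_iff]
        exact Or.inl (by_contra fun h => hx (N.mem_left_of_cond (y := y) (by simpa using h)))
      rw [this, zero_mul, mul_zero]
  | succ k ih =>
    calc N.transIter (k + 1 + 1) x y
        = ∑' v, ∑' w, N.trans x v * (N.transIter k v w * N.trans w y) := by
          rw [transIter_succ]
          exact tsum_congr fun v => by rw [ih, ENNReal.tsum_mul_left]
      _ = ∑' w, ∑' v, N.trans x v * (N.transIter k v w * N.trans w y) := ENNReal.tsum_comm
      _ = _ := tsum_congr fun w => by
          rw [transIter_succ, ← ENNReal.tsum_mul_right]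
          exact tsum_congr fun v => (mul_assoc _ _ _).symm

lemma tsum_transIter_le (k x : ℕ) : ∑' y, N.transIter k x y ≤ 1 := by
  induction k generalizing x with
  | zero =>
    rw [tsum_eq_single x fun w hw => N.transIter_zero_ne hw.symm]
    simp only [transIter]
    split_ifs <;> simp
  | succ k ih =>
    simp only [transIter_succ]
    rw [ENNReal.tsum_comm]
    simp_rw [ENNReal.tsum_mul_left]
    calc ∑' w, N.trans x w * ∑' y, N.transIter k w y ≤ ∑' w, N.trans x w * 1 := by
          gcongr; exact ih _
      _ ≤ 1 := by simpa using N.tsum_trans_le x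

/-- Detailed balance passes to k steps by peeling off the first step on one side and the last step
on the other. -/
lemma condAt_mul_transIter (k x y : ℕ) :
    N.condAt x * N.transIter k x y = N.condAt y * N.transIter k y x := by
  induction k generalizing x y with
  | zero =>
    by_cases h : x = y
    · rw [h]
    · rw [N.transIter_zero_ne h, N.transIter_zero_ne (Ne.symm h), mul_zero, mul_zero]
  | succ k ih =>
    rw [transIter_succ, transIter_succ', ← ENNReal.tsum_mul_left, ← ENNReal.tsum_mul_left]
    refine tsum_congr fun w => ?_
    rw [← mul_assoc, condAt_mul_trans, ← mul_assoc, ← ih, mul_right_comm, condAt_mul_trans,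
      Sym2.eq_swap]

lemma transIter_eq_zero_of_notMem {k x y : ℕ} (h : y ∉ N.verts) :
    N.transIter k x y = 0 := by
  cases k with
  | zero =>
    by_cases hx : x = y
    · simp [transIter, hx, h]
    · exact N.transIter_zero_ne hx
  | succ k =>
    rw [transIter_succ']
    simp [N.trans_eq_zero_of_notMem h]

lemma transIter_mul_eq_zero_of_condAt {k x y : ℕ} (hx : N.condAt x ≠ 0) (h : N.condAt y = 0) :
    N.transIter k x y = 0 := by
  have := N.condAt_mul_transIter k x y
  rw [h, zero_mul, mul_eq_zero] at this
  exact this.resolve_left hx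

/-- A mixture of the transition probabilities over all numbers of steps. -/
noncomputable def green (x y : ℕ) : ℝ≥0∞ := ∑' k : ℕ, 2⁻¹ ^ (k + 1) * N.transIter k x y

lemma green_le_one (x y : ℕ) : N.green x y ≤ 1 := by
  calc N.green x y ≤ ∑' k : ℕ, 2⁻¹ ^ (k + 1) * 1 := by
        refine ENNReal.tsum_le_tsum fun k => ?_
        gcongr
        exact (ENNReal.le_tsum y).trans (N.tsum_transIter_le k x)
    _ = 1 := by
      simp only [mul_one, pow_succ]
      rw [ENNReal.tsum_mul_right, ENNReal.tsum_geometric, ENNReal.one_sub_inv_two, inv_inv]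
      exact ENNReal.mul_inv_cancel two_ne_zero ENNReal.ofNat_ne_top

lemma condAt_mul_green (x y : ℕ) : N.condAt x * N.green x y = N.condAt y * N.green y x := by
  simp only [green, ← ENNReal.tsum_mul_left]
  refine tsum_congr fun k => ?_
  rw [mul_left_comm, condAt_mul_transIter, mul_left_comm]

lemma green_eq_zero_of_condAt {x y : ℕ} (hx : N.condAt x ≠ 0) (h : N.condAt y = 0) :
    N.green x y = 0 := by
  simp [green, N.transIter_mul_eq_zero_of_condAt hx h]

variable {N}

lemma trans_ne_zero {x y : ℕ} (h : N.cond s(x, y) ≠ 0) : N.trans x y ≠ 0 := by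
  rw [trans, Ne, ENNReal.div_eq_zero_iff]
  simp [h, N.condAt_ne_top]

/-- A path of positive conductance with k edges makes the k-step probability positive, and every k
has positive weight in the mixture. -/
lemma green_ne_zero (h : N.PosConnected) {x y : ℕ} (hx : N.condAt x ≠ 0)
    (hy : N.condAt y ≠ 0) : N.green x y ≠ 0 := by
  obtain ⟨p⟩ := h x y (pos_iff_ne_zero.2 hx) (pos_iff_ne_zero.2 hy)
  have : ∃ k, N.transIter k x y ≠ 0 := by
    clear hy
    induction p with
    | nil => exact ⟨0, by simp [N.transIter_zero_self (N.mem_verts_of_condAt hx)]⟩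
    | @cons u v w huv q ih =>
      rw [SimpleGraph.fromEdgeSet_adj] at huv
      obtain ⟨k, hk⟩ := ih fun h => (ne_of_gt huv.1)
        (by simpa using (N.cond_le_condAt_right u v).trans h.le)
      refine ⟨k + 1, ?_⟩
      rw [transIter_succ, Ne, ENNReal.tsum_eq_zero]
      intro h0
      exact mul_ne_zero (trans_ne_zero (ne_of_gt huv.1)) hk (h0 v)
  obtain ⟨k, hk⟩ := this
  rw [green, Ne, ENNReal.tsum_eq_zero]
  intro h0
  exact mul_ne_zero (pow_ne_zero _ (by simp)) hk (h0 k)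

end Network

end Kernel

/-! ### From one-step reversibility to mass transport -/

section MassTransport

variable {Ξ : Type*} [MeasurableSpace Ξ]

lemma measurable_rooted :
    Measurable fun N : RootedNetwork Ξ => (N.toNetwork, N.root) := comap_measurable _

lemma measurable_toNetwork : Measurable fun N : RootedNetwork Ξ => N.toNetwork :=
  measurable_fst.comp measurable_rooted

lemma measurable_root : Measurable fun N : RootedNetwork Ξ => N.root :=
  measurable_snd.comp measurable_rooted

lemma measurable_uncurry {f : Network Ξ → ℕ → ℝ≥0∞} (hf : ∀ x, Measurable fun N => f N x) :
    Measurable fun q : Network Ξ × ℕ => f q.1 q.2 :=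
  measurable_from_prod_countable_left hf

lemma measurable_uncurry₂ {f : Network Ξ → ℕ → ℕ → ℝ≥0∞}
    (hf : ∀ x y, Measurable fun N => f N x y) :
    Measurable fun q : Network Ξ × ℕ × ℕ => f q.1 q.2.1 q.2.2 :=
  measurable_from_prod_countable_left (f := fun q : Network Ξ × ℕ × ℕ => f q.1 q.2.1 q.2.2)
    fun p => hf p.1 p.2

lemma measurable_at_root {f : Network Ξ → ℕ → ℝ≥0∞} (hf : ∀ x, Measurable fun N => f N x) :
    Measurable fun N : RootedNetwork Ξ => f N.toNetwork N.root :=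
  (measurable_uncurry hf).comp measurable_rooted

lemma Natural1.measurable_at_root {f : Network Ξ → ℕ → ℝ≥0∞} (hf : Natural1 f) :
    Measurable fun N : RootedNetwork Ξ => f N.toNetwork N.root :=
  RevNet.measurable_at_root fun x => hf.meas' x

lemma measurable_rooted_pair (v : ℕ) :
    Measurable fun N : RootedNetwork Ξ => (N.toNetwork, N.root, v) :=
  measurable_toNetwork.prodMk (measurable_root.prodMk measurable_const)

lemma lintegral_stepLaw (μ : Measure (RootedNetwork Ξ)) {f : Network Ξ × ℕ × ℕ → ℝ≥0∞}
    (hf : Measurable f) :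
    ∫⁻ q, f q ∂(stepLaw μ) =
      ∫⁻ N, ∑' v, N.trans N.root v * f (N.toNetwork, N.root, v) ∂μ := by
  have h1 : ∀ v, Measurable fun N : RootedNetwork Ξ => N.trans N.root v := fun v =>
    measurable_at_root (f := fun N x => N.trans x v) fun x => natural_trans.meas' x v
  have h2 : ∀ v, Measurable fun N : RootedNetwork Ξ => f (N.toNetwork, N.root, v) := fun v =>
    hf.comp (measurable_rooted_pair v)
  have h3 : ∀ v, Measurable fun N : RootedNetwork Ξ =>
      N.trans N.root v * f (N.toNetwork, N.root, v) := fun v => (h1 v).mul (h2 v)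
  rw [stepLaw, lintegral_sum_measure, lintegral_tsum fun v => (h3 v).aemeasurable]
  refine tsum_congr fun v => ?_
  rw [lintegral_map hf (measurable_rooted_pair v),
    lintegral_withDensity_eq_lintegral_mul _ (h1 v) (h2 v)]
  rfl

/-- The σ-algebra of measurable isomorphism-invariant sets of doubly rooted networks. -/
@[reducible]
def invariantSigma : MeasurableSpace (Network Ξ × ℕ × ℕ) where
  MeasurableSet' A := MeasurableSet A ∧ IsInvariant A
  measurableSet_empty := ⟨MeasurableSet.empty, fun _ _ _ _ _ => Iff.rfl⟩
  measurableSet_compl A h := ⟨h.1.compl, fun N N' φ x y => not_congr (h.2 N N' φ x y)⟩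
  measurableSet_iUnion A h := ⟨MeasurableSet.iUnion fun i => (h i).1, fun N N' φ x y => by
    simp only [Set.mem_iUnion]
    exact exists_congr fun i => (h i).2 N N' φ x y⟩

lemma invariantSigma_le : (invariantSigma : MeasurableSpace (Network Ξ × ℕ × ℕ)) ≤
    Prod.instMeasurableSpace :=
  fun _ h => h.1

/-- Reversibility compares the two laws only on invariant sets, so both are restricted to the
invariant σ-algebra, where they are equal as measures and where natural functions are measurable. -/
lemma IsReversible.lintegral_step {μ : Measure (RootedNetwork Ξ)} (hμ : IsReversible μ)
    {f : Network Ξ → ℕ → ℕ → ℝ≥0∞} (hf : Natural2 f) :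
    ∫⁻ N, ∑' v, N.trans N.root v * f N.toNetwork N.root v ∂μ =
      ∫⁻ N, ∑' v, N.trans N.root v * f N.toNetwork v N.root ∂μ := by
  have hm : Measurable fun q : Network Ξ × ℕ × ℕ => f q.1 q.2.1 q.2.2 :=
    measurable_uncurry₂ hf.meas'
  have hswap : Measurable fun q : Network Ξ × ℕ × ℕ => (q.1, q.2.2, q.2.1) :=
    measurable_fst.prodMk ((measurable_snd.comp measurable_snd).prodMk
      (measurable_fst.comp measurable_snd))
  have hinv : Measurable[invariantSigma] fun q : Network Ξ × ℕ × ℕ => f q.1 q.2.1 q.2.2 := by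
    intro A hA
    refine ⟨hm hA, fun N N' φ x y => ?_⟩
    simp only [Set.mem_preimage]
    rw [hf.inv' N N' φ x y]
  have htrim : (stepLaw μ).trim invariantSigma_le =
      ((stepLaw μ).map fun q => (q.1, q.2.2, q.2.1)).trim invariantSigma_le := by
    refine @Measure.ext _ invariantSigma _ _ fun A hA => ?_
    rw [trim_measurableSet_eq _ hA, trim_measurableSet_eq _ hA, Measure.map_apply hswap hA.1]
    exact hμ.step_symm A hA.1 hA.2
  have key : ∫⁻ q, f q.1 q.2.1 q.2.2 ∂(stepLaw μ) = ∫⁻ q, f q.1 q.2.2 q.2.1 ∂(stepLaw μ) := by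
    rw [← lintegral_trim invariantSigma_le hinv, htrim, lintegral_trim invariantSigma_le hinv,
      lintegral_map hm hswap]
  rwa [lintegral_stepLaw μ hm,
    lintegral_stepLaw μ (f := fun q => f q.1 q.2.2 q.2.1) (hm.comp hswap)] at key

lemma natural_transIter (k : ℕ) : Natural2 fun (N : Network Ξ) x y => N.transIter k x y := by
  classical
  induction k with
  | zero =>
    have h : Natural fun (_ : Network Ξ) e => if e 0 = e 1 then (1 : ℝ≥0∞) else 0 := by
      convert Natural.ite (NaturalProp.eq_vertex 0 1) (Natural.const 1) (Natural.const 0)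
    exact Natural.ite (NaturalProp.vert 0) h (Natural.const 0)
  | succ k ih =>
    exact Natural.tsum_vertex ((natural_trans.app 1 0).mul (ih.app 0 2)) fun N y e hy =>
      mul_eq_zero_of_left (N.trans_eq_zero_of_notMem hy) _

lemma natural_green : Natural2 fun (N : Network Ξ) x y => N.green x y :=
  Natural.tsum fun k => (Natural.const _).mul ((natural_transIter k).app 0 1)

variable {μ : Measure (RootedNetwork Ξ)} {f : Network Ξ → ℕ → ℕ → ℝ≥0∞}

/-- In the inductive step the first of the k + 1 steps is reversed with the remaining k summed out,
and then the other k steps are reversed by the induction hypothesis. -/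
lemma IsReversible.lintegral_transIter (hμ : IsReversible μ) (hf : Natural2 f) (k : ℕ) :
    ∫⁻ N, ∑' v, N.transIter k N.root v * f N.toNetwork N.root v ∂μ =
      ∫⁻ N, ∑' v, N.transIter k N.root v * f N.toNetwork v N.root ∂μ := by
  induction k generalizing f with
  | zero =>
    refine lintegral_congr fun N => ?_
    rw [tsum_eq_single N.root fun w hw => by rw [N.transIter_zero_ne hw.symm, zero_mul],
      tsum_eq_single N.root fun w hw => by rw [N.transIter_zero_ne hw.symm, zero_mul]]
  | succ k ih =>
    have hg : Natural2 fun (N : Network Ξ) x w => ∑' y, N.transIter k w y * f N x y :=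
      Natural.tsum_vertex (((natural_transIter k).app 2 0).mul (hf.app 1 0)) fun N y e hy =>
        mul_eq_zero_of_left (N.transIter_eq_zero_of_notMem hy) _
    have hh : Natural2 fun (N : Network Ξ) x y => ∑' w, N.trans x w * f N w y :=
      Natural.tsum_vertex ((natural_trans.app 1 0).mul (hf.app 0 2)) fun N y e hy =>
        mul_eq_zero_of_left (N.trans_eq_zero_of_notMem hy) _
    calc ∫⁻ N, ∑' v, N.transIter (k + 1) N.root v * f N.toNetwork N.root v ∂μ
        = ∫⁻ N, ∑' w, N.trans N.root w *
            ∑' y, N.transIter k w y * f N.toNetwork N.root y ∂μ := by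
          refine lintegral_congr fun N => ?_
          simp_rw [Network.transIter_succ, ← ENNReal.tsum_mul_right, ← ENNReal.tsum_mul_left]
          rw [ENNReal.tsum_comm]
          simp_rw [mul_assoc]
      _ = ∫⁻ N, ∑' w, N.trans N.root w *
            ∑' y, N.transIter k N.root y * f N.toNetwork w y ∂μ := hμ.lintegral_step hg
      _ = ∫⁻ N, ∑' y, N.transIter k N.root y *
            ∑' w, N.trans N.root w * f N.toNetwork w y ∂μ := by
          refine lintegral_congr fun N => ?_
          simp_rw [← ENNReal.tsum_mul_left]
          rw [ENNReal.tsum_comm]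
          simp_rw [mul_left_comm]
      _ = ∫⁻ N, ∑' y, N.transIter k N.root y *
            ∑' w, N.trans y w * f N.toNetwork w N.root ∂μ := ih hh
      _ = _ := by
          refine lintegral_congr fun N => ?_
          simp_rw [Network.transIter_succ', ← ENNReal.tsum_mul_right, ← ENNReal.tsum_mul_left]
          rw [ENNReal.tsum_comm]
          simp_rw [mul_assoc]

lemma IsReversible.lintegral_green (hμ : IsReversible μ) (hf : Natural2 f) :
    ∫⁻ N, ∑' v, N.green N.root v * f N.toNetwork N.root v ∂μ =
      ∫⁻ N, ∑' v, N.green N.root v * f N.toNetwork v N.root ∂μ := by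
  have key : ∀ g : Network Ξ → ℕ → ℕ → ℝ≥0∞, Natural2 g →
      ∫⁻ N, ∑' v, N.green N.root v * g N.toNetwork N.root v ∂μ =
        ∑' k : ℕ, 2⁻¹ ^ (k + 1) *
          ∫⁻ N, ∑' v, N.transIter k N.root v * g N.toNetwork N.root v ∂μ := by
    intro g hg
    have hn : ∀ k, Natural1 fun (N : Network Ξ) x => ∑' v, N.transIter k x v * g N x v :=
      fun k => Natural.tsum_vertex (((natural_transIter k).app 1 0).mul (hg.app 1 0))
        fun N y e hy => mul_eq_zero_of_left (N.transIter_eq_zero_of_notMem hy) _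
    simp_rw [← lintegral_const_mul _ (hn _).measurable_at_root]
    rw [← lintegral_tsum fun k => ((hn k).measurable_at_root.const_mul _).aemeasurable]
    refine lintegral_congr fun N => ?_
    simp_rw [Network.green, ← ENNReal.tsum_mul_right, ← ENNReal.tsum_mul_left]
    rw [ENNReal.tsum_comm]
    simp_rw [mul_assoc]
  rw [key f hf, key (fun N x y => f N y x) (hf.app 1 0)]
  simp_rw [hμ.lintegral_transIter hf]

/-- The mass transport principle for reversible random networks. -/
theorem IsReversible.mass_transport (hμ : IsReversible μ) (hconn : ∀ᵐ N ∂μ, N.PosConnected)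
    (hf : Natural2 f) :
    ∫⁻ N, ∑' y, N.condAt y * f N.toNetwork N.root y ∂μ =
      ∫⁻ N, ∑' y, N.condAt y * f N.toNetwork y N.root ∂μ := by
  have hF : Natural2 fun (N : Network Ξ) x y => N.condAt y * f N x y / N.green x y :=
    ((natural_condAt.app 1).mul (hf.app 0 1)).div (natural_green.app 0 1)
  have hfin : ∀ (N : Network Ξ) x y, N.green x y ≠ ∞ := fun N x y =>
    ((N.green_le_one x y).trans_lt ENNReal.one_lt_top).ne
  -- Dividing by the kernel turns its reversibility into mass transport: after the exchange the
  -- factor c_ρ green(ρ,y) / green(y,ρ) equals c_y by detailed balance. Almost surely the divisor is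
  -- nonzero wherever c_y is.
  rw [lintegral_congr_ae (g := fun N => ∑' y, N.green N.root y *
      (N.condAt y * f N.toNetwork N.root y / N.green N.root y)), hμ.lintegral_green hF]
  · refine lintegral_congr_ae ?_
    filter_upwards [hμ.condAt_root_pos, hconn] with N hN hc
    refine tsum_congr fun y => ?_
    by_cases hy : N.condAt y = 0
    · rw [hy, zero_mul, N.green_eq_zero_of_condAt hN.ne' hy, zero_mul]
    · rw [div_eq_mul_inv, mul_right_comm, ← mul_assoc, ← mul_assoc,
        mul_comm _ (N.condAt _), N.condAt_mul_green, mul_assoc (N.condAt y),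
        ENNReal.mul_inv_cancel (Network.green_ne_zero hc hy hN.ne') (hfin _ _ _), mul_one]
  · filter_upwards [hμ.condAt_root_pos, hconn] with N hN hc
    refine tsum_congr fun y => ?_
    by_cases hy : N.condAt y = 0
    · rw [hy, zero_mul, ENNReal.zero_div, mul_zero]
    · rw [ENNReal.mul_div_cancel (Network.green_ne_zero hc hN.ne' hy) (hfin _ _ _)]

end MassTransport

/-! ### Equilibrium potentials and Dirichlet's principle -/

section Potential

variable {Ξ : Type*}

/-- The absolute value of the difference of two extended nonnegative numbers. -/
noncomputable def absDiff (a b : ℝ≥0∞) : ℝ≥0∞ := (a - b) + (b - a)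

lemma absDiff_self (a : ℝ≥0∞) : absDiff a a = 0 := by simp [absDiff]

lemma absDiff_comm (a b : ℝ≥0∞) : absDiff a b = absDiff b a := add_comm _ _

lemma absDiff_triangle (a b c : ℝ≥0∞) : absDiff a c ≤ absDiff a b + absDiff b c := by
  have h1 : a - c ≤ (a - b) + (b - c) := tsub_le_tsub_add_tsub
  have h2 : c - a ≤ (c - b) + (b - a) := tsub_le_tsub_add_tsub
  calc absDiff a c ≤ ((a - b) + (b - c)) + ((c - b) + (b - a)) := add_le_add h1 h2
    _ = absDiff a b + absDiff b c := by simp only [absDiff]; ring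

lemma absDiff_zero_one : absDiff 0 1 = 1 := by simp [absDiff]

lemma absDiff_eq_ofReal {a b : ℝ≥0∞} (ha : a ≠ ∞) (hb : b ≠ ∞) :
    absDiff a b = ENNReal.ofReal |a.toReal - b.toReal| := by
  lift a to ℝ≥0 using ha
  lift b to ℝ≥0 using hb
  simp only [ENNReal.coe_toReal, absDiff]
  rcases le_total a b with h | h
  · have h' : (a : ℝ) ≤ b := h
    rw [tsub_eq_zero_of_le (ENNReal.coe_le_coe.2 h), zero_add, abs_sub_comm,
      abs_of_nonneg (by linarith), ENNReal.ofReal_sub _ (NNReal.coe_nonneg a)]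
    simp
  · have h' : (b : ℝ) ≤ a := h
    rw [tsub_eq_zero_of_le (ENNReal.coe_le_coe.2 h), add_zero,
      abs_of_nonneg (by linarith), ENNReal.ofReal_sub _ (NNReal.coe_nonneg b)]
    simp

namespace Network

variable (N : Network Ξ)

/-- The Dirichlet energy as a sum over oriented edges. -/
noncomputable def orientedEnergy (f : ℕ → ℝ) : ℝ≥0∞ :=
  ∑' p : ℕ × ℕ, (N.cond s(p.1, p.2) : ℝ≥0∞) * ENNReal.ofReal ((f p.1 - f p.2) ^ 2)

/-- An ordered pair is determined by its unordered pair and one bit, the order of its entries, so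
each edge is counted at most twice. -/
lemma orientedEnergy_le (f : ℕ → ℝ) : N.orientedEnergy f ≤ 2 * N.energy f := by
  set F : Sym2 ℕ → ℝ≥0∞ := fun e => (N.cond e : ℝ≥0∞) * (edgeDiff f e : ℝ≥0∞) ^ 2
  have h1 : ∀ p : ℕ × ℕ, (N.cond s(p.1, p.2) : ℝ≥0∞) * ENNReal.ofReal ((f p.1 - f p.2) ^ 2)
      = F s(p.1, p.2) := by
    intro p
    simp only [F, edgeDiff, Sym2.lift_mk]
    congr 1
    rw [← sq_abs, ENNReal.ofReal_pow (abs_nonneg _), ← Real.dist_eq, ← edist_dist,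
      edist_nndist]
  have hinj : Function.Injective fun p : ℕ × ℕ => (s(p.1, p.2), decide (p.1 ≤ p.2)) := by
    rintro ⟨a, b⟩ ⟨c, d⟩ h
    simp only [Prod.mk.injEq, Sym2.eq_iff, decide_eq_decide] at h
    obtain ⟨⟨rfl, rfl⟩ | ⟨rfl, rfl⟩, h⟩ := h
    · rfl
    · have : a = b := by omega
      rw [this]
  calc N.orientedEnergy f = ∑' p : ℕ × ℕ, F s(p.1, p.2) := tsum_congr h1
    _ ≤ ∑' q : Sym2 ℕ × Bool, F q.1 :=
      ENNReal.tsum_comp_le_tsum_of_injective hinj fun q => F q.1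
    _ = ∑' e : Sym2 ℕ, ∑' _ : Bool, F e := ENNReal.tsum_prod (f := fun e _ => F e)
    _ = 2 * N.energy f := by
      rw [energy, ← ENNReal.tsum_mul_left]
      exact tsum_congr fun e => by simp [two_mul, F]

variable {N}

/-- The energy of g is that of f plus that of g - f plus a cross term, which vanishes after
summation by parts since at each point either f is harmonic or g = f. -/
lemma sum_energy_le_of_harmonic {a : ℕ → ℕ → ℝ} (ha : ∀ y w, 0 ≤ a y w)
    (hsymm : ∀ y w, a y w = a w y) {f g : ℕ → ℝ} {W : Finset ℕ}
    (h : ∀ y ∈ W, (∑ w ∈ W, a y w * (f y - f w)) * (g y - f y) = 0) :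
    ∑ y ∈ W, ∑ w ∈ W, a y w * (f y - f w) ^ 2 ≤ ∑ y ∈ W, ∑ w ∈ W, a y w * (g y - g w) ^ 2 := by
  have hcross1 : ∑ y ∈ W, ∑ w ∈ W, a y w * (f y - f w) * (g y - f y) = 0 := by
    refine Finset.sum_eq_zero fun y hy => ?_
    rw [← Finset.sum_mul, h y hy]
  have hcross2 : ∑ y ∈ W, ∑ w ∈ W, a y w * (f y - f w) * (g w - f w) = 0 := by
    rw [Finset.sum_comm, ← neg_eq_zero, ← Finset.sum_neg_distrib, ← hcross1]
    refine Finset.sum_congr rfl fun y _ => ?_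
    rw [← Finset.sum_neg_distrib]
    refine Finset.sum_congr rfl fun w _ => ?_
    rw [hsymm w y]
    ring
  have key : ∑ y ∈ W, ∑ w ∈ W, a y w * (g y - g w) ^ 2 =
      ∑ y ∈ W, ∑ w ∈ W, a y w * (f y - f w) ^ 2 +
      ∑ y ∈ W, ∑ w ∈ W, a y w * ((g y - f y) - (g w - f w)) ^ 2 +
      2 * (∑ y ∈ W, ∑ w ∈ W, a y w * (f y - f w) * (g y - f y) -
        ∑ y ∈ W, ∑ w ∈ W, a y w * (f y - f w) * (g w - f w)) := by
    simp only [← Finset.sum_add_distrib, ← Finset.sum_sub_distrib, Finset.mul_sum]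
    refine Finset.sum_congr rfl fun y _ => Finset.sum_congr rfl fun w _ => ?_
    ring
  rw [key, hcross1, hcross2, sub_zero, mul_zero, add_zero]
  exact le_add_of_nonneg_right (Finset.sum_nonneg fun y _ => Finset.sum_nonneg fun w _ =>
    mul_nonneg (ha _ _) (sq_nonneg _))

lemma sum_orientedEnergy (N : Network Ξ) (k : ℕ → ℝ) (W : Finset ℕ) :
    ∑ p ∈ W ×ˢ W, (N.cond s(p.1, p.2) : ℝ≥0∞) * ENNReal.ofReal ((k p.1 - k p.2) ^ 2) =
      ENNReal.ofReal (∑ y ∈ W, ∑ w ∈ W, (N.cond s(y, w) : ℝ) * (k y - k w) ^ 2) := by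
  rw [← Finset.sum_product', ENNReal.ofReal_sum_of_nonneg fun p _ =>
    mul_nonneg (NNReal.coe_nonneg _) (sq_nonneg _)]
  refine Finset.sum_congr rfl fun p _ => ?_
  rw [ENNReal.ofReal_mul (NNReal.coe_nonneg _), ENNReal.ofReal_coe_nnreal]

/-- Dirichlet's principle: a function that is harmonic on the finite set `I` has least energy among
the functions with the same values off `I`. -/
lemma orientedEnergy_le_of_harmonic {f g : ℕ → ℝ} {I W : Finset ℕ} (hIW : I ⊆ W)
    (hW : ∀ y ∈ W, y ∈ N.verts) (hnb : ∀ y ∈ I, ∀ w, N.cond s(y, w) ≠ 0 → w ∈ W)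
    (hfg : ∀ y ∈ N.verts, y ∉ I → f y = g y)
    (hharm : ∀ y ∈ I, ∑ w ∈ W, (N.cond s(y, w) : ℝ) * (f y - f w) = 0) :
    N.orientedEnergy f ≤ N.orientedEnergy g := by
  have hreal : ∑ y ∈ W, ∑ w ∈ W, (N.cond s(y, w) : ℝ) * (f y - f w) ^ 2 ≤
      ∑ y ∈ W, ∑ w ∈ W, (N.cond s(y, w) : ℝ) * (g y - g w) ^ 2 := by
    refine sum_energy_le_of_harmonic (fun y w => NNReal.coe_nonneg _)
      (fun y w => by rw [Sym2.eq_swap]) fun y hy => ?_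
    by_cases hyI : y ∈ I
    · rw [hharm y hyI, zero_mul]
    · rw [hfg y (hW y hy) hyI, sub_self, mul_zero]
  -- The full energy may be infinite. Only pairs inside the finite set W need comparing: an edge not
  -- inside W has no end in I, so f and g agree on it.
  have hsplit : ∀ k : ℕ → ℝ, N.orientedEnergy k =
      ENNReal.ofReal (∑ y ∈ W, ∑ w ∈ W, (N.cond s(y, w) : ℝ) * (k y - k w) ^ 2) +
      ∑' p : ↑((W ×ˢ W : Finset (ℕ × ℕ)) : Set (ℕ × ℕ))ᶜ,
        (fun p : ℕ × ℕ => (N.cond s(p.1, p.2) : ℝ≥0∞) *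
          ENNReal.ofReal ((k p.1 - k p.2) ^ 2)) p := fun k => by
    rw [← sum_orientedEnergy, orientedEnergy]
    exact (ENNReal.sum_add_tsum_compl (W ×ˢ W) fun p : ℕ × ℕ => (N.cond s(p.1, p.2) : ℝ≥0∞) *
          ENNReal.ofReal ((k p.1 - k p.2) ^ 2)).symm
  rw [hsplit, hsplit]
  refine add_le_add (ENNReal.ofReal_le_ofReal hreal) (le_of_eq (tsum_congr ?_))
  rintro ⟨⟨y, w⟩, hp⟩
  rw [Set.mem_compl_iff, Finset.mem_coe, Finset.mem_product] at hp
  by_cases hc : N.cond s(y, w) = 0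
  · simp only [hc, ENNReal.coe_zero, zero_mul]
  · have hy : y ∉ I := fun hy => hp ⟨hIW hy, hnb y hy w hc⟩
    have hw : w ∉ I := fun hw => hp ⟨hnb w hw y (by rwa [Sym2.eq_swap]), hIW hw⟩
    simp only
    rw [hfg y (N.mem_left_of_cond hc) hy, hfg w (N.mem_right_of_cond hc) hw]

/-- The probability that the random walk from `y`, stopped on leaving the ball of radius `R` around
`x`, has left it after `k` steps without visiting the ball of radius `q`. -/
noncomputable def exitProb (N : Network Ξ) (q R : ℕ) : ℕ → ℕ → ℕ → ℝ≥0∞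
  | 0, x, y => open Classical in if N.Near R x y then 0 else 1
  | k + 1, x, y => open Classical in
      if N.Near q x y then 0 else
        if N.Near R x y then ∑' w, N.trans y w * N.exitProb q R k x w else 1

/-- The equilibrium potential: the probability that the walk from `y` leaves the ball of radius
`R` around `x` before visiting the ball of radius `q`. -/
noncomputable def potential (N : Network Ξ) (q R x y : ℕ) : ℝ≥0∞ := ⨆ k, N.exitProb q R k x y

/-- Twice the Dirichlet energy of the equilibrium potential. -/
noncomputable def potEnergy (N : Network Ξ) (q R x : ℕ) : ℝ≥0∞ :=
  ∑' y, ∑' w, (N.cond s(y, w) : ℝ≥0∞) * absDiff (N.potential q R x y) (N.potential q R x w) ^ 2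

variable {q R k x y : ℕ}

lemma exitProb_le_one (k : ℕ) : N.exitProb q R k x y ≤ 1 := by
  induction k generalizing y with
  | zero => simp only [exitProb]; split_ifs <;> simp
  | succ k ih =>
    simp only [exitProb]
    split_ifs
    · simp
    · calc ∑' w, N.trans y w * N.exitProb q R k x w ≤ ∑' w, N.trans y w * 1 := by
            gcongr; exact ih
        _ ≤ 1 := by simpa using N.tsum_trans_le y
    · simp

lemma exitProb_near (hqR : q ≤ R) (h : N.Near q x y) : N.exitProb q R k x y = 0 := by
  cases k with
  | zero => simp [exitProb, h.mono hqR]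
  | succ k => simp [exitProb, h]

lemma exitProb_far (hqR : q ≤ R) (h : ¬ N.Near R x y) : N.exitProb q R k x y = 1 := by
  cases k with
  | zero => simp [exitProb, h]
  | succ k =>
    have : ¬ N.Near q x y := fun h' => h (h'.mono hqR)
    simp [exitProb, h, this]

/-- Monotonicity makes `potential` an increasing limit of explicit functions. Obtained this way, the
minimiser of the energy is visibly natural, with no choice involved. -/
lemma exitProb_mono (hqR : q ≤ R) : Monotone fun k => N.exitProb q R k x y := by
  refine monotone_nat_of_le_succ fun k => ?_
  induction k generalizing y with
  | zero =>
    by_cases h : N.Near R x y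
    · simp [exitProb, h]
    · rw [exitProb_far hqR h, exitProb_far hqR h]
  | succ k ih =>
    rw [exitProb]
    conv_rhs => rw [exitProb]
    split_ifs
    · exact le_rfl
    · gcongr
      exact ih
    · exact le_rfl

lemma potential_le_one : N.potential q R x y ≤ 1 := iSup_le exitProb_le_one

lemma potential_near (hqR : q ≤ R) (h : N.Near q x y) : N.potential q R x y = 0 := by
  simp [potential, exitProb_near hqR h]

lemma potential_far (hqR : q ≤ R) (h : ¬ N.Near R x y) : N.potential q R x y = 1 := by
  simp [potential, exitProb_far hqR h]

lemma potential_ne_top : N.potential q R x y ≠ ∞ :=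
  (potential_le_one.trans_lt ENNReal.one_lt_top).ne

/-- The one-step recursion of `exitProb` passes to the limit by monotone convergence for counting
measure. -/
lemma potential_harmonic (hqR : q ≤ R) (h : ¬ N.Near q x y) (h' : N.Near R x y) :
    N.potential q R x y = ∑' w, N.trans y w * N.potential q R x w := by
  have h1 : N.potential q R x y = ⨆ k, N.exitProb q R (k + 1) x y :=
    ((exitProb_mono hqR).iSup_nat_add 1).symm
  have h2 : ∀ k, N.exitProb q R (k + 1) x y = ∑' w, N.trans y w * N.exitProb q R k x w :=
    fun k => by simp [exitProb, h, h']
  simp_rw [h1, h2, potential, ENNReal.mul_iSup, ← lintegral_count]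
  rw [lintegral_iSup (fun k => measurable_of_countable _)]
  intro i j hij w
  dsimp only
  gcongr
  exact exitProb_mono hqR hij

lemma potential_harmonic_real (hqR : q ≤ R) (h : ¬ N.Near q x y) (h' : N.Near R x y)
    {W : Finset ℕ} (hW : ∀ w, N.cond s(y, w) ≠ 0 → w ∈ W) :
    ∑ w ∈ W, (N.cond s(y, w) : ℝ) *
      ((N.potential q R x y).toReal - (N.potential q R x w).toReal) = 0 := by
  have hz : ∀ w ∉ W, N.cond s(y, w) = 0 := fun w hw => by
    by_contra hc
    exact hw (hW w hc)
  have h1 : N.condAt y * N.potential q R x y =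
      ∑ w ∈ W, (N.cond s(y, w) : ℝ≥0∞) * N.potential q R x w := by
    rw [potential_harmonic hqR h h', ← ENNReal.tsum_mul_left]
    simp_rw [← mul_assoc, condAt_mul_trans]
    exact tsum_eq_sum fun w hw => by simp [hz w hw]
  have h2 : N.condAt y = ∑ w ∈ W, (N.cond s(y, w) : ℝ≥0∞) :=
    tsum_eq_sum fun w hw => by simp [hz w hw]
  rw [h2, Finset.sum_mul] at h1
  have h3 := congrArg ENNReal.toReal h1
  rw [ENNReal.toReal_sum fun w _ => ENNReal.mul_ne_top ENNReal.coe_ne_top potential_ne_top,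
    ENNReal.toReal_sum fun w _ => ENNReal.mul_ne_top ENNReal.coe_ne_top potential_ne_top] at h3
  simp only [ENNReal.toReal_mul, ENNReal.coe_toReal] at h3
  simp only [mul_sub, Finset.sum_sub_distrib, h3, sub_self]

lemma potEnergy_eq (q R x : ℕ) :
    N.potEnergy q R x = N.orientedEnergy fun y => (N.potential q R x y).toReal := by
  rw [potEnergy, orientedEnergy, ENNReal.tsum_prod
    (f := fun y w => (N.cond s(y, w) : ℝ≥0∞) * ENNReal.ofReal
      (((N.potential q R x y).toReal - (N.potential q R x w).toReal) ^ 2))]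
  refine tsum_congr fun y => tsum_congr fun w => ?_
  rw [absDiff_eq_ofReal potential_ne_top potential_ne_top, ← ENNReal.ofReal_pow (abs_nonneg _),
    sq_abs]

/-- Dirichlet's principle with the annulus between the radii q and R as interior; the ball of radius
R + 1 contains all its neighbours. -/
lemma potEnergy_le_orientedEnergy (hqR : q ≤ R) {g : ℕ → ℝ}
    (h0 : ∀ y, N.Near q x y → g y = 0) (h1 : ∀ y ∈ N.verts, ¬ N.Near R x y → g y = 1) :
    N.potEnergy q R x ≤ N.orientedEnergy g := by
  classical
  rw [potEnergy_eq]
  set W := (N.finite_near (R + 1) x).toFinset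
  have hmemW : ∀ y, y ∈ W ↔ N.Near (R + 1) x y := fun y => by simp [W]
  have hI : ∀ y, y ∈ W.filter (fun y => N.Near R x y ∧ ¬ N.Near q x y) ↔
      N.Near R x y ∧ ¬ N.Near q x y := fun y => by
    rw [Finset.mem_filter, hmemW, and_iff_right_iff_imp]
    exact fun h => h.1.mono R.le_succ
  have hnb : ∀ y, N.Near R x y → ∀ w, N.cond s(y, w) ≠ 0 → w ∈ W := fun y hy w hw =>
    (hmemW w).2 (hy.trans (near_one_of_edge (N.edge_of_cond_ne_zero hw)))
  refine orientedEnergy_le_of_harmonic (Finset.filter_subset _ W) (fun y hy => ((hmemW y).1 hy).2.1)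
    (fun y hy w hw => hnb y ((hI y).1 hy).1 w hw) (fun y hyv hy => ?_)
    fun y hy => potential_harmonic_real hqR ((hI y).1 hy).2 ((hI y).1 hy).1
      (hnb y ((hI y).1 hy).1)
  rw [hI, not_and, not_not] at hy
  by_cases hR : N.Near R x y
  · rw [potential_near hqR (hy hR), h0 y (hy hR), ENNReal.toReal_zero]
  · rw [potential_far hqR hR, h1 y hyv hR, ENNReal.toReal_one]

/-- A lower bound on an effective resistance bounds the energy of the equilibrium potential. -/
lemma potEnergy_le_of_effRes {r : ℝ} (hr : 0 ≤ r) (hqR : ⌊r⌋₊ ≤ R) (hx : x ∈ N.verts)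
    {Z : ℝ≥0∞} (hZ : Z ≤ N.effRes (N.ball x r) (N.ballCompl x R)) :
    N.potEnergy ⌊r⌋₊ R x ≤ 2 * Z⁻¹ := by
  have key : N.potEnergy ⌊r⌋₊ R x / 2 ≤
      (N.effRes (N.ball x r) (N.ballCompl x R))⁻¹ := by
    rw [effRes, inv_inv]
    refine le_iInf fun g => le_iInf fun h0 => le_iInf fun h1 => ?_
    refine ENNReal.div_le_of_le_mul' ((potEnergy_le_orientedEnergy hqR (fun y hy => ?_)
      fun y hyv hy => ?_).trans (N.orientedEnergy_le g))
    · exact h0 y ((mem_ball_iff hx hr).2 hy)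
    · refine h1 y ⟨hyv, fun hb => hy ?_⟩
      rwa [mem_ball_iff hx (Nat.cast_nonneg R), Nat.floor_natCast] at hb
  calc N.potEnergy ⌊r⌋₊ R x = 2 * (N.potEnergy ⌊r⌋₊ R x / 2) :=
        (ENNReal.mul_div_cancel two_ne_zero ENNReal.ofNat_ne_top).symm
    _ ≤ 2 * Z⁻¹ := by gcongr; exact key.trans (ENNReal.inv_le_inv.2 hZ)

lemma cond_eq_zero_of_notMem (N : Network Ξ) {x y : ℕ} (h : y ∉ N.verts) :
    (N.cond s(x, y) : ℝ≥0∞) = 0 := by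
  rw [ENNReal.coe_eq_zero]
  by_contra hc
  exact h (N.mem_right_of_cond hc)

end Network

variable [MeasurableSpace Ξ]

lemma natural_exitProb (q R k : ℕ) :
    Natural2 fun (N : Network Ξ) x y => N.exitProb q R k x y := by
  classical
  induction k with
  | zero => exact Natural.ite ((natural_near R).app 0 1) (Natural.const 0) (Natural.const 1)
  | succ k ih =>
    refine Natural.ite ((natural_near q).app 0 1) (Natural.const 0)
      (Natural.ite ((natural_near R).app 0 1) ?_ (Natural.const 1))
    exact Natural.tsum_vertex ((natural_trans.app 2 0).mul (ih.app 1 0)) fun N y e hy =>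
      mul_eq_zero_of_left (N.trans_eq_zero_of_notMem hy) _

lemma natural_potential (q R : ℕ) :
    Natural2 fun (N : Network Ξ) x y => N.potential q R x y :=
  Natural.iSup fun k => (natural_exitProb q R k).app 0 1

lemma Natural.absDiff {F G : Network Ξ → (ℕ → ℕ) → ℝ≥0∞} (hF : Natural F) (hG : Natural G) :
    Natural fun N e => absDiff (F N e) (G N e) := (hF.sub hG).add (hG.sub hF)

lemma natural_potEnergy (q R : ℕ) :
    Natural1 fun (N : Network Ξ) x => N.potEnergy q R x := by
  have h : Natural2 fun (N : Network Ξ) x y => ∑' w, (N.cond s(y, w) : ℝ≥0∞) *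
      RevNet.absDiff (N.potential q R x y) (N.potential q R x w) ^ 2 :=
    Natural.tsum_vertex ((Natural.cond 2 0).mul ((((natural_potential q R).app 1 2).absDiff
      ((natural_potential q R).app 1 0)).pow 2)) fun N y e hy =>
      mul_eq_zero_of_left (N.cond_eq_zero_of_notMem hy) _
  refine Natural.tsum_vertex (h.app 1 0) fun N y e hy => ENNReal.tsum_eq_zero.2 fun w => ?_
  refine mul_eq_zero_of_left ?_ _
  rw [Sym2.eq_swap]
  exact N.cond_eq_zero_of_notMem hy

end Potential

/-! ### The Cauchy-Schwarz inequality for extended nonnegative sums -/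

section CauchySchwarz

lemma two_mul_mul_le_sq_add_sq (a b : ℝ≥0∞) : 2 * (a * b) ≤ a ^ 2 + b ^ 2 := by
  by_cases ha : a = ∞
  · simp [ha]
  by_cases hb : b = ∞
  · simp [hb]
  lift a to ℝ≥0 using ha
  lift b to ℝ≥0 using hb
  norm_cast
  rw [← mul_assoc]
  exact two_mul_le_add_sq a b

/-- The square is expanded as a double sum and 2 b_i b_j ≤ b_i² + b_j² is applied termwise, which
needs no finiteness. -/
lemma sq_tsum_mul_le {ι : Type*} (a b : ι → ℝ≥0∞) :
    (∑' i, a i * b i) ^ 2 ≤ (∑' i, a i) * ∑' i, a i * b i ^ 2 := by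
  have h : 2 * (∑' i, a i * b i) ^ 2 ≤ 2 * ((∑' i, a i) * ∑' i, a i * b i ^ 2) := by
    calc 2 * (∑' i, a i * b i) ^ 2
        = ∑' i, ∑' j, a i * a j * (2 * (b i * b j)) := by
          rw [sq, ← ENNReal.tsum_mul_right, ← ENNReal.tsum_mul_left]
          refine tsum_congr fun i => ?_
          rw [← ENNReal.tsum_mul_left, ← ENNReal.tsum_mul_left]
          exact tsum_congr fun j => by ring
      _ ≤ ∑' i, ∑' j, a i * a j * (b i ^ 2 + b j ^ 2) := by
          gcongr
          exact two_mul_mul_le_sq_add_sq _ _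
      _ = ∑' i, ∑' j, (a i * b i ^ 2 * a j + a i * (a j * b j ^ 2)) :=
          tsum_congr fun i => tsum_congr fun j => by ring
      _ = 2 * ((∑' i, a i) * ∑' i, a i * b i ^ 2) := by
          simp_rw [ENNReal.tsum_add, ENNReal.tsum_mul_left, ENNReal.tsum_mul_right]
          ring
  exact (ENNReal.mul_le_mul_iff_right two_ne_zero ENNReal.ofNat_ne_top).1 h

end CauchySchwarz

/-! ### The pseudometric of one scale -/

section Scale

variable {Ξ : Type*}

/-- The parameters of a spatial scale: the radii `q ≤ R` of the annulus on which equilibrium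
potentials live, a smaller radius `t`, and bounds on volumes and energies. -/
structure Scale where
  q : ℕ
  R : ℕ
  t : ℕ
  U : ℝ≥0∞
  L : ℝ≥0∞
  E : ℝ≥0∞

namespace Network

variable (N : Network Ξ) (S : Scale)

/-- The volumes around `x` and the equilibrium potential of `x` obey the bounds of the scale. -/
def Good (x : ℕ) : Prop :=
  ((0 < N.condAt x ∧ N.nvol (4 * S.R) x ≤ S.U) ∧ S.L ≤ N.nvol S.t x) ∧
    N.potEnergy S.q S.R x ≤ S.E

/-- The total conductance of the good vertices in a ball. -/
noncomputable def goodVol (r x : ℕ) : ℝ≥0∞ :=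
  open Classical in ∑' y, if N.Near r x y then (if N.Good S y then N.condAt y else 0) else 0

/-- The intensity of centres of equilibrium potentials. -/
noncomputable def intensity (r x : ℕ) : ℝ≥0∞ :=
  open Classical in if N.Good S x then (N.goodVol S (2 * r) x)⁻¹ else 0

/-- The distance obtained by averaging the equilibrium potentials of all good centres. -/
noncomputable def scaleDist (r y w : ℕ) : ℝ≥0∞ :=
  ∑' x, N.condAt x * N.intensity S r x *
    absDiff (N.potential S.q S.R x y) (N.potential S.q S.R x w)

variable {N S} {r k l x y w : ℕ}

lemma Good.mem (h : N.Good S x) : x ∈ N.verts := N.mem_verts_of_condAt h.1.1.1.ne'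

lemma condAt_le_nvol (hx : x ∈ N.verts) : N.condAt x ≤ N.nvol r x := by
  classical
  refine le_trans ?_ (ENNReal.le_tsum x)
  rw [if_pos (Near.refl r hx)]

lemma Good.condAt_le_goodVol (h : N.Good S x) : N.condAt x ≤ N.goodVol S r x := by
  classical
  refine le_trans ?_ (ENNReal.le_tsum x)
  rw [if_pos (Near.refl r h.mem), if_pos h]

lemma goodVol_le_nvol : N.goodVol S r x ≤ N.nvol r x := by
  classical
  refine ENNReal.tsum_le_tsum fun y => ?_
  split_ifs <;> simp

lemma goodVol_le_of_near (h : N.Near k x y) (hl : k + r ≤ l) :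
    N.goodVol S r y ≤ N.goodVol S l x := by
  classical
  refine ENNReal.tsum_le_tsum fun z => ?_
  by_cases hz : N.Near r y z
  · rw [if_pos hz, if_pos ((h.trans hz).mono hl)]
  · rw [if_neg hz]
    exact zero_le

lemma intensity_of_good (h : N.Good S x) :
    N.intensity S r x = (N.goodVol S (2 * r) x)⁻¹ := if_pos h

lemma intensity_of_not_good (h : ¬ N.Good S x) : N.intensity S r x = 0 := if_neg h

lemma good_of_intensity_ne_zero (h : N.intensity S r x ≠ 0) : N.Good S x := by
  by_contra h'
  exact h (intensity_of_not_good h')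

-- A ball of radius 2r about a centre x within r of y contains the ball of radius r about y, so
-- every such intensity is at most the inverse good volume of the latter ball.
open Classical in
lemma tsum_intensity_le_one (r y : ℕ) :
    ∑' x, (if N.Near r y x then N.condAt x * N.intensity S r x else 0) ≤ 1 := by
  calc ∑' x, (if N.Near r y x then N.condAt x * N.intensity S r x else 0)
      ≤ ∑' x, (if N.Near r y x then (if N.Good S x then N.condAt x else 0) else 0) *
          (N.goodVol S r y)⁻¹ := by
        refine ENNReal.tsum_le_tsum fun x => ?_
        by_cases hx : N.Near r y x
        · by_cases hg : N.Good S x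
          · rw [if_pos hx, if_pos hx, if_pos hg, intensity_of_good hg]
            gcongr
            exact goodVol_le_of_near hx.symm (by omega)
          · rw [if_pos hx, intensity_of_not_good hg, mul_zero]
            exact zero_le
        · rw [if_neg hx]
          exact zero_le
    _ = N.goodVol S r y * (N.goodVol S r y)⁻¹ := by rw [ENNReal.tsum_mul_right, goodVol]
    _ ≤ 1 := ENNReal.mul_inv_le_one _

lemma Good.nvol_mul_inv (hg : N.Good S x) (hU : S.U ≠ ∞) (hr : r ≤ 4 * S.R) :
    N.nvol r x * (N.nvol r x)⁻¹ = 1 := by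
  refine ENNReal.mul_inv_cancel ?_ ?_
  · exact (hg.1.1.1.trans_le (condAt_le_nvol hg.mem)).ne'
  · exact (((N.nvol_mono x hr).trans hg.1.1.2).trans_lt hU.lt_top).ne

lemma Good.inv_nvol_le (hg : N.Good S x) (hr : S.t ≤ r) : (N.nvol r x)⁻¹ ≤ S.L⁻¹ :=
  ENNReal.inv_le_inv.2 (hg.1.2.trans (N.nvol_mono x hr))

open Classical in
/-- The total mass of the centres near a good vertex. -/
lemma tsum_intensity_le (hg : N.Good S x) (hU : S.U ≠ ∞) (htr : S.t ≤ r) (hr : r ≤ S.R)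
    (hR : 2 ≤ S.R) :
    ∑' z, (if N.Near (2 * S.R + 2) x z then N.condAt z * N.intensity S r z else 0) ≤
      S.U * S.L⁻¹ := by
  -- The mass of each centre z is spread uniformly over its r-ball, of volume at least L. After
  -- exchanging the sums, each y within 4R of x sees mass at most 1. The radii fit because 2R + 2 +
  -- r ≤ 4R when r ≤ R and 2 ≤ R.
  calc ∑' z, (if N.Near (2 * S.R + 2) x z then N.condAt z * N.intensity S r z else 0)
      ≤ ∑' z, S.L⁻¹ * ∑' y, (if N.Near (4 * S.R) x y then N.condAt y else 0) *
          (if N.Near r y z then N.condAt z * N.intensity S r z else 0) := by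
        refine ENNReal.tsum_le_tsum fun z => ?_
        by_cases hz : N.Near (2 * S.R + 2) x z
        swap
        · rw [if_neg hz]; exact zero_le
        by_cases hgz : N.Good S z
        swap
        · rw [if_pos hz, intensity_of_not_good hgz, mul_zero]; exact zero_le
        rw [if_pos hz]
        calc N.condAt z * N.intensity S r z
            = (N.condAt z * N.intensity S r z) * (N.nvol r z * (N.nvol r z)⁻¹) := by
              rw [hgz.nvol_mul_inv hU (by omega), mul_one]
          _ = (N.nvol r z)⁻¹ * (N.nvol r z * (N.condAt z * N.intensity S r z)) := by ring
          _ ≤ S.L⁻¹ * (N.nvol r z * (N.condAt z * N.intensity S r z)) := by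
              gcongr
              simpa using hgz.inv_nvol_le htr
          _ ≤ _ := by
              gcongr
              rw [nvol, ← ENNReal.tsum_mul_right]
              refine ENNReal.tsum_le_tsum fun y => ?_
              by_cases hy : N.Near r z y
              · rw [if_pos hy, if_pos hy.symm, if_pos ((hz.trans hy).mono (by omega))]
              · rw [if_neg hy, zero_mul]; exact zero_le
    _ = S.L⁻¹ * ∑' y, (if N.Near (4 * S.R) x y then N.condAt y else 0) *
          ∑' z, (if N.Near r y z then N.condAt z * N.intensity S r z else 0) := by
        rw [ENNReal.tsum_mul_left, ENNReal.tsum_comm]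
        simp_rw [ENNReal.tsum_mul_left]
    _ ≤ S.L⁻¹ * ∑' y, (if N.Near (4 * S.R) x y then N.condAt y else 0) * 1 := by
        gcongr
        exact tsum_intensity_le_one _ _
    _ = S.L⁻¹ * N.nvol (4 * S.R) x := by simp_rw [mul_one, nvol]
    _ ≤ S.U * S.L⁻¹ := by
        rw [mul_comm]
        gcongr
        exact hg.1.1.2

lemma near_of_absDiff_ne_zero (hq : S.q ≤ S.R) (he : s(y, w) ∈ N.edges)
    (h : absDiff (N.potential S.q S.R x y) (N.potential S.q S.R x w) ≠ 0) :
    N.Near (S.R + 1) x y := by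
  by_cases hy : N.Near S.R x y
  · exact hy.mono (by omega)
  · by_cases hw : N.Near S.R x w
    · exact hw.trans (near_one_of_edge (by rwa [Sym2.eq_swap]))
    · rw [potential_far hq hy, potential_far hq hw, absDiff_self] at h
      exact absurd rfl h

/-- Centres that contribute to an edge at y lie within R + 1 of y, hence within 2R + 2 of any one of
them, x₀. As x₀ is good, the total mass is at most U/L, and this is the constant in Cauchy-Schwarz.
-/
lemma sq_scaleDist_le (hU : S.U ≠ ∞) (hq : S.q ≤ S.R) (htr : S.t ≤ r) (hr : r ≤ S.R)
    (hR : 2 ≤ S.R) (he : s(y, w) ∈ N.edges) :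
    N.scaleDist S r y w ^ 2 ≤ S.U * S.L⁻¹ * ∑' x, N.condAt x * N.intensity S r x *
      absDiff (N.potential S.q S.R x y) (N.potential S.q S.R x w) ^ 2 := by
  classical
  by_cases h0 : N.scaleDist S r y w = 0
  · rw [h0]; simp
  rw [scaleDist, ENNReal.tsum_eq_zero, not_forall] at h0
  obtain ⟨x₀, hx₀⟩ := h0
  have hgood : ∀ x, N.condAt x * N.intensity S r x *
      absDiff (N.potential S.q S.R x y) (N.potential S.q S.R x w) ≠ 0 →
      N.Good S x ∧ N.Near (S.R + 1) x y := fun x hx => by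
    have hg := good_of_intensity_ne_zero (right_ne_zero_of_mul (left_ne_zero_of_mul hx))
    exact ⟨hg, near_of_absDiff_ne_zero hq he (right_ne_zero_of_mul hx)⟩
  set a : ℕ → ℝ≥0∞ := fun x =>
    if N.Near (2 * S.R + 2) x₀ x then N.condAt x * N.intensity S r x else 0 with ha
  set b : ℕ → ℝ≥0∞ := fun x => absDiff (N.potential S.q S.R x y) (N.potential S.q S.R x w)
  have h1 : N.scaleDist S r y w ≤ ∑' x, a x * b x := by
    refine ENNReal.tsum_le_tsum fun x => ?_
    by_cases hx : N.condAt x * N.intensity S r x * b x = 0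
    · rw [hx]; exact zero_le
    · have hn : N.Near (2 * S.R + 2) x₀ x :=
        ((hgood x₀ hx₀).2.trans (hgood x hx).2.symm).mono (by omega)
      simp only [ha]
      rw [if_pos hn]
  calc N.scaleDist S r y w ^ 2 ≤ (∑' x, a x * b x) ^ 2 := by gcongr
    _ ≤ (∑' x, a x) * ∑' x, a x * b x ^ 2 := sq_tsum_mul_le a b
    _ ≤ S.U * S.L⁻¹ * ∑' x, N.condAt x * N.intensity S r x * b x ^ 2 := by
        gcongr with x
        · exact tsum_intensity_le (hgood x₀ hx₀).1 hU htr hr hR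
        · simp only [ha]
          split_ifs <;> simp

/-- The distance is large across an annulus around a good vertex. -/
lemma goodVol_mul_inv_le_scaleDist (hq : S.q ≤ S.R)
    (hr : 2 * r ≤ S.q) (hy : ¬ N.Near (2 * S.R) x y) :
    N.goodVol S (2 * r) x * (N.goodVol S (4 * r) x)⁻¹ ≤ N.scaleDist S r x y := by
  classical
  rw [goodVol, ← ENNReal.tsum_mul_right]
  refine ENNReal.tsum_le_tsum fun z => ?_
  by_cases hz : N.Near (2 * r) x z
  swap
  · rw [if_neg hz, zero_mul]; exact zero_le
  by_cases hg : N.Good S z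
  swap
  · rw [if_pos hz, if_neg hg, zero_mul]; exact zero_le
  -- The potential of a good centre z within 2r of x is 0 at x and 1 at y, so z contributes its full
  -- mass, at least c_z divided by the good volume in the ball of radius 4r about x.
  have h1 : ¬ N.Near S.R z y := fun h => hy ((hz.trans h).mono (by omega))
  rw [if_pos hz, if_pos hg, potential_near hq (hz.symm.mono hr), potential_far hq h1,
    absDiff_zero_one, mul_one, intensity_of_good hg]
  gcongr
  exact goodVol_le_of_near hz (by omega)

end Network

variable [MeasurableSpace Ξ] (S : Scale)

lemma natural_good : NaturalProp1 fun (N : Network Ξ) x => N.Good S x :=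
  (((NaturalProp.lt (Natural.const 0) (natural_condAt.app 0)).and
    (NaturalProp.le ((natural_nvol _).app 0) (Natural.const _))).and
    (NaturalProp.le (Natural.const _) ((natural_nvol _).app 0))).and
    (NaturalProp.le ((natural_potEnergy _ _).app 0) (Natural.const _))

lemma natural_goodVol (r : ℕ) : Natural1 fun (N : Network Ξ) x => N.goodVol S r x := by
  classical
  exact Natural.tsum_vertex (Natural.ite ((natural_near r).app 1 0)
    (Natural.ite ((natural_good S).app 0) (natural_condAt.app 0) (Natural.const 0))
    (Natural.const 0)) fun _ _ _ hy => if_neg fun h => hy h.2.1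

lemma Natural.inv' {F : Network Ξ → (ℕ → ℕ) → ℝ≥0∞} (hF : Natural F) :
    Natural fun N e => (F N e)⁻¹ :=
  ⟨fun e => (hF.meas e).inv, fun N N' φ e => by rw [hF.inv N N' φ]⟩

lemma natural_intensity (r : ℕ) : Natural1 fun (N : Network Ξ) x => N.intensity S r x := by
  classical
  exact Natural.ite ((natural_good S).app 0) ((natural_goodVol S (2 * r)).app 0).inv'
    (Natural.const 0)

lemma natural_scaleDist (r : ℕ) : Natural2 fun (N : Network Ξ) x y => N.scaleDist S r x y :=
  Natural.tsum_vertex (((natural_condAt.app 0).mul ((natural_intensity S r).app 0)).mul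
    (((natural_potential S.q S.R).app 0 1).absDiff ((natural_potential S.q S.R).app 0 2)))
    fun N _ _ hy => mul_eq_zero_of_left (mul_eq_zero_of_left (N.condAt_eq_zero_of_notMem hy) _) _

variable {S} {r : ℕ} {μ : Measure (RootedNetwork Ξ)} [IsProbabilityMeasure μ]

/-- Each vertex spreads its intensity evenly over its r-ball. The root receives at most 1/L times
the mass of the centres within r, which is at most 1/L. -/
lemma IsReversible.lintegral_intensity_le (hμ : IsReversible μ)
    (hconn : ∀ᵐ N ∂μ, N.PosConnected) (hU : S.U ≠ ∞) (htr : S.t ≤ r) (hr : r ≤ S.R) :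
    ∫⁻ N, N.intensity S r N.root ∂μ ≤ S.L⁻¹ := by
  classical
  have hf : Natural2 fun (N : Network Ξ) x y =>
      if N.Near r x y then N.intensity S r x * (N.nvol r x)⁻¹ else 0 :=
    Natural.ite ((natural_near r).app 0 1)
      (((natural_intensity S r).app 0).mul ((natural_nvol r).app 0).inv') (Natural.const 0)
  calc ∫⁻ N, N.intensity S r N.root ∂μ
      = ∫⁻ N, ∑' y, N.condAt y * (if N.Near r N.root y then
          N.intensity S r N.root * (N.nvol r N.root)⁻¹ else 0) ∂μ := by
        refine lintegral_congr fun N => ?_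
        by_cases hg : N.Good S N.root
        · calc N.intensity S r N.root
              = N.nvol r N.root * (N.nvol r N.root)⁻¹ * N.intensity S r N.root := by
                rw [hg.nvol_mul_inv hU (by omega), one_mul]
            _ = _ := by
                rw [mul_assoc, mul_comm (N.nvol r N.root)⁻¹]
                conv_lhs => rw [Network.nvol, ← ENNReal.tsum_mul_right]
                refine tsum_congr fun y => ?_
                split_ifs
                · rfl
                · rw [zero_mul, mul_zero]
        · simp [Network.intensity_of_not_good hg]
    _ = ∫⁻ N, ∑' y, N.condAt y * (if N.Near r y N.root then
          N.intensity S r y * (N.nvol r y)⁻¹ else 0) ∂μ := hμ.mass_transport hconn hf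
    _ ≤ ∫⁻ N, S.L⁻¹ ∂μ := by
        refine lintegral_mono fun N => ?_
        calc ∑' y, N.condAt y * (if N.Near r y N.root then
              N.intensity S r y * (N.nvol r y)⁻¹ else 0)
            ≤ ∑' y, S.L⁻¹ * (if N.Near r N.root y then
              N.condAt y * N.intensity S r y else 0) := by
              refine ENNReal.tsum_le_tsum fun y => ?_
              by_cases hy : N.Near r y N.root
              swap
              · rw [if_neg hy, mul_zero]; exact zero_le
              by_cases hg : N.Good S y
              swap
              · rw [Network.intensity_of_not_good hg]; simp
              rw [if_pos hy, if_pos hy.symm, ← mul_assoc, mul_comm]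
              gcongr
              simpa using hg.inv_nvol_le htr
          _ ≤ S.L⁻¹ * 1 := by
              rw [ENNReal.tsum_mul_left]
              gcongr
              exact Network.tsum_intensity_le_one _ _
          _ = S.L⁻¹ := mul_one _
    _ = S.L⁻¹ := by simp

/-- The second moment of the distance across a random edge. -/
lemma IsReversible.lintegral_sq_scaleDist_le (hμ : IsReversible μ)
    (hconn : ∀ᵐ N ∂μ, N.PosConnected) (hU : S.U ≠ ∞) (hq : S.q ≤ S.R) (htr : S.t ≤ r)
    (hr : r ≤ S.R) (hR : 2 ≤ S.R) :
    ∫⁻ N, ∑' w, N.trans N.root w * N.scaleDist S r N.root w ^ 2 ∂μ ≤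
      S.U * S.L⁻¹ * (S.E * S.L⁻¹) := by
  have hf : Natural2 fun (N : Network Ξ) x y => N.intensity S r x *
      ∑' w, N.trans y w * absDiff (N.potential S.q S.R x y) (N.potential S.q S.R x w) ^ 2 :=
    ((natural_intensity S r).app 0).mul (Natural.tsum_vertex ((natural_trans.app 2 0).mul
      ((((natural_potential S.q S.R).app 1 2).absDiff
        ((natural_potential S.q S.R).app 1 0)).pow 2)) fun N y e hy =>
      mul_eq_zero_of_left (N.trans_eq_zero_of_notMem hy) _)
  have hmeas : Measurable fun N : RootedNetwork Ξ => ∑' y, N.condAt y * (N.intensity S r y *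
      ∑' w, N.trans N.root w * absDiff (N.potential S.q S.R y N.root)
        (N.potential S.q S.R y w) ^ 2) := by
    refine Natural1.measurable_at_root (f := fun N x => ∑' y, N.condAt y * (N.intensity S r y *
      ∑' w, N.trans x w * absDiff (N.potential S.q S.R y x)
        (N.potential S.q S.R y w) ^ 2)) ?_
    exact Natural.tsum_vertex ((natural_condAt.app 0).mul (hf.app 0 1)) fun N y e hy =>
      mul_eq_zero_of_left (N.condAt_eq_zero_of_notMem hy) _
  calc ∫⁻ N, ∑' w, N.trans N.root w * N.scaleDist S r N.root w ^ 2 ∂μ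
      ≤ ∫⁻ N, S.U * S.L⁻¹ * ∑' y, N.condAt y * (N.intensity S r y *
          ∑' w, N.trans N.root w * absDiff (N.potential S.q S.R y N.root)
            (N.potential S.q S.R y w) ^ 2) ∂μ := by
        refine lintegral_mono fun N => ?_
        calc ∑' w, N.trans N.root w * N.scaleDist S r N.root w ^ 2
            ≤ ∑' w, N.trans N.root w * (S.U * S.L⁻¹ * ∑' x, N.condAt x * N.intensity S r x *
                absDiff (N.potential S.q S.R x N.root) (N.potential S.q S.R x w) ^ 2) := by
              refine ENNReal.tsum_le_tsum fun w => ?_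
              by_cases he : s(N.root, w) ∈ N.edges
              · gcongr
                exact Network.sq_scaleDist_le hU hq htr hr hR he
              · have : N.trans N.root w = 0 := by simp [Network.trans, N.cond_eq_zero _ he]
                rw [this, zero_mul, zero_mul]
          _ = _ := by
              simp_rw [← ENNReal.tsum_mul_left]
              rw [ENNReal.tsum_comm]
              refine tsum_congr fun x => tsum_congr fun w => ?_
              ring
    _ = S.U * S.L⁻¹ * ∫⁻ N, ∑' y, N.condAt y * (N.intensity S r y *
          ∑' w, N.trans N.root w * absDiff (N.potential S.q S.R y N.root)
            (N.potential S.q S.R y w) ^ 2) ∂μ := lintegral_const_mul _ hmeas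
    -- Mass transport makes the root the centre of the potential; the sum over edges then becomes
    -- the whole energy of that potential.
    _ = S.U * S.L⁻¹ * ∫⁻ N, ∑' y, N.condAt y * (N.intensity S r N.root *
          ∑' w, N.trans y w * absDiff (N.potential S.q S.R N.root y)
            (N.potential S.q S.R N.root w) ^ 2) ∂μ := by
        rw [← hμ.mass_transport hconn hf]
    _ ≤ S.U * S.L⁻¹ * ∫⁻ N, S.E * N.intensity S r N.root ∂μ := by
        gcongr with N
        by_cases hg : N.Good S N.root
        swap
        · simp [Network.intensity_of_not_good hg]
        calc ∑' y, N.condAt y * (N.intensity S r N.root *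
              ∑' w, N.trans y w * absDiff (N.potential S.q S.R N.root y)
                (N.potential S.q S.R N.root w) ^ 2)
            = N.intensity S r N.root * N.potEnergy S.q S.R N.root := by
              simp_rw [Network.potEnergy, ← Network.condAt_mul_trans, ← ENNReal.tsum_mul_left]
              refine tsum_congr fun y => tsum_congr fun w => ?_
              ring
          _ ≤ S.E * N.intensity S r N.root := by
              rw [mul_comm]
              gcongr
              exact hg.2
    _ = S.U * S.L⁻¹ * (S.E * ∫⁻ N, N.intensity S r N.root ∂μ) := by
        rw [lintegral_const_mul _ (natural_intensity S r).measurable_at_root]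
    _ ≤ _ := by
        gcongr
        exact hμ.lintegral_intensity_le hconn hU htr hr

end Scale

/-! ### Marks computed from the network -/

section Attach

variable {Ξ Ξ' : Type*}

/-- Replace the marks of a network. -/
def Network.attach (W : Network Ξ → Sym2 ℕ → Ξ') (N : Network Ξ) : Network Ξ' where
  verts := N.verts
  edges := N.edges
  cond := N.cond
  mark := W N
  mem_of_edge := N.mem_of_edge
  cond_eq_zero := N.cond_eq_zero
  locallyFinite := N.locallyFinite
  connected := N.connected

/-- Replace the marks of a rooted network. -/
def RootedNetwork.attach (W : Network Ξ → Sym2 ℕ → Ξ') (N : RootedNetwork Ξ) :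
    RootedNetwork Ξ' where
  toNetwork := N.toNetwork.attach W
  root := N.root
  root_mem := N.root_mem

variable [MeasurableSpace Ξ] [MeasurableSpace Ξ'] {W : Network Ξ → Sym2 ℕ → Ξ'}

lemma measurable_attach (hW : ∀ e, Measurable fun N => W N e) :
    Measurable (Network.attach W) := by
  have h : Measurable fun N : Network Ξ => (N.verts, N.edges, N.cond, W N) :=
    (measurable_fst.comp measurable_network_data).prodMk
      ((measurable_fst.comp (measurable_snd.comp measurable_network_data)).prodMk
        ((measurable_fst.comp (measurable_snd.comp (measurable_snd.comp
          measurable_network_data))).prodMk (measurable_pi_lambda _ hW)))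
  exact measurable_comap_iff.2 h

lemma measurable_rooted_attach (hW : ∀ e, Measurable fun N => W N e) :
    Measurable (RootedNetwork.attach W) :=
  measurable_comap_iff.2
    (((measurable_attach hW).comp measurable_toNetwork).prodMk measurable_root)

lemma lintegral_stepLaw_attach (hW : ∀ e, Measurable fun N => W N e)
    (μ : Measure (RootedNetwork Ξ)) {f : Network Ξ' × ℕ × ℕ → ℝ≥0∞} (hf : Measurable f) :
    ∫⁻ q, f q ∂(stepLaw (μ.map (RootedNetwork.attach W))) =
      ∫⁻ q, f (q.1.attach W, q.2) ∂(stepLaw μ) := by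
  have hg : Measurable fun q : Network Ξ × ℕ × ℕ => f (q.1.attach W, q.2) :=
    hf.comp (((measurable_attach hW).comp measurable_fst).prodMk measurable_snd)
  rw [lintegral_stepLaw _ hf, lintegral_stepLaw _ hg, lintegral_map _ (measurable_rooted_attach hW)]
  · rfl
  · exact Measurable.tsum fun v =>
      (measurable_at_root (f := fun N x => N.trans x v) fun x => natural_trans.meas' x v).mul
        (hf.comp (measurable_rooted_pair v))

/-- Equivariance of the marks turns an isomorphism of networks into one of marked networks, so
invariant sets pull back to invariant sets. -/
lemma IsReversible.attach {μ : Measure (RootedNetwork Ξ)} (hμ : IsReversible μ)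
    (hW : ∀ e, Measurable fun N => W N e)
    (hinv : ∀ (N N' : Network Ξ) (φ : N.Iso N') (x y : N.verts),
      s((x : ℕ), (y : ℕ)) ∈ N.edges →
      W N s((x : ℕ), (y : ℕ)) = W N' s((φ.toEquiv x : ℕ), (φ.toEquiv y : ℕ))) :
    IsReversible (μ.map (RootedNetwork.attach W)) := by
  refine ⟨?_, fun A hA hAinv => ?_⟩
  · rw [ae_map_iff (measurable_rooted_attach hW).aemeasurable]
    · exact hμ.condAt_root_pos
    · exact measurableSet_lt measurable_const natural_condAt.measurable_at_root
  · have hm : Measurable fun q : Network Ξ × ℕ × ℕ => (q.1.attach W, q.2) :=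
      ((measurable_attach hW).comp measurable_fst).prodMk measurable_snd
    have hswap : Measurable fun q : Network Ξ' × ℕ × ℕ => (q.1, q.2.2, q.2.1) :=
      measurable_fst.prodMk ((measurable_snd.comp measurable_snd).prodMk
        (measurable_fst.comp measurable_snd))
    have key : ∀ B : Set (Network Ξ' × ℕ × ℕ), MeasurableSet B →
        stepLaw (μ.map (RootedNetwork.attach W)) B =
          stepLaw μ {q | (q.1.attach W, q.2) ∈ B} := fun B hB => by
      have hB' : MeasurableSet {q : Network Ξ × ℕ × ℕ | (q.1.attach W, q.2) ∈ B} := hm hB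
      rw [← lintegral_indicator_one hB,
        lintegral_stepLaw_attach hW _ (measurable_one.indicator hB),
        ← lintegral_indicator_one hB']
      rfl
    rw [key A hA, key {q | (q.1, q.2.2, q.2.1) ∈ A} (hswap hA)]
    refine hμ.step_symm _ (hm hA) fun N N' φ x y => ?_
    exact hAinv (N.attach W) (N'.attach W)
      ⟨φ.toEquiv, φ.edge_iff, φ.cond_eq, fun a b hab => hinv N N' φ a b hab⟩ x y

end Attach

/-! ### Edge weights dominating a pseudometric, with edges of zero conductance -/

section EdgeLength

variable {Ξ : Type*}

/-- An isomorphism-invariant pseudometric on the vertices of networks. -/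
structure NaturalDist [MeasurableSpace Ξ] (D : Network Ξ → ℕ → ℕ → ℝ≥0∞) : Prop where
  natural : Natural2 D
  self : ∀ N x, D N x x = 0
  symm : ∀ N x y, D N x y = D N y x
  triangle : ∀ N x y z, D N x z ≤ D N x y + D N y z

namespace Network

variable (N : Network Ξ) (D : Network Ξ → ℕ → ℕ → ℝ≥0∞) (m : ℕ)

/-- An upper bound for the distances between vertices of positive conductance in a ball. -/
noncomputable def coreDiam (k v : ℕ) : ℝ≥0∞ :=
  open Classical in ∑' x, ∑' y, if N.Near k v x then if N.Near k v y then
    if 0 < N.condAt x then if 0 < N.condAt y then D N x y else 0 else 0 else 0 else 0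

/-- The length given to edges of zero conductance at `v`. -/
noncomputable def detour (v : ℕ) : ℝ≥0∞ :=
  open Classical in
    -- The power charges for straying k away from positive conductance. The radius k + 2 reaches the
    -- feet of neighbours of v: they are at distance 1 from v and have height at most k + 1 when v
    -- has height k.
    ⨅ k : ℕ, if 0 < N.nvol k v then ((2 * k) ^ m : ℕ) + N.coreDiam D (k + 2) v else ∞

/-- Edge lengths, whose path metric dominates `D` and grows away from the vertices of positive
conductance. -/
noncomputable def edgeLength (v w : ℕ) : ℝ≥0∞ :=
  open Classical in if 0 < (N.cond s(v, w) : ℝ≥0∞) then max (D N v w) (D N w v) else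
    N.detour D m v + N.detour D m w

lemma edgeLength_comm (v w : ℕ) : N.edgeLength D m v w = N.edgeLength D m w v := by
  rw [edgeLength, edgeLength, Sym2.eq_swap, max_comm, add_comm]

/-- The edge weight given by `edgeLength`. -/
noncomputable def edgeWeight (e : Sym2 ℕ) : ℝ≥0 :=
  (Sym2.lift ⟨N.edgeLength D m, N.edgeLength_comm D m⟩ e).toNNReal

lemma edgeWeight_mk (v w : ℕ) : N.edgeWeight D m s(v, w) = (N.edgeLength D m v w).toNNReal := rfl

/-- The distance to the vertices of positive conductance. -/
noncomputable def height (v : ℕ) : ℕ := sInf {k | N.nvol k v ≠ 0}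

/-- `a` is a vertex of positive conductance closest to `v`. -/
def IsFoot (v a : ℕ) : Prop := N.condAt a ≠ 0 ∧ N.Near (N.height v) v a

variable {N D m} {k l v w a b x : ℕ}

lemma nvol_ne_zero : N.nvol k v ≠ 0 ↔ ∃ a, N.condAt a ≠ 0 ∧ N.Near k v a := by
  rw [nvol, Ne, ENNReal.tsum_eq_zero]
  simp [and_comm]

lemma height_le (ha : N.condAt a ≠ 0) (h : N.Near k v a) : N.height v ≤ k :=
  Nat.sInf_le (nvol_ne_zero.2 ⟨a, ha, h⟩)

lemma exists_isFoot (hx : N.condAt x ≠ 0) (hv : v ∈ N.verts) : ∃ a, N.IsFoot v a := by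
  have h : N.nvol (N.height v) v ≠ 0 :=
    Nat.sInf_mem (s := {k | N.nvol k v ≠ 0}) ⟨N.graph.dist v x,
      nvol_ne_zero.2 ⟨x, hx, hv, N.mem_verts_of_condAt hx, le_rfl⟩⟩
  exact nvol_ne_zero.1 h

lemma height_eq_zero (hv : N.condAt v ≠ 0) : N.height v = 0 :=
  Nat.le_zero.1 (height_le hv (Near.refl 0 (N.mem_verts_of_condAt hv)))

lemma isFoot_self (hv : N.condAt v ≠ 0) : N.IsFoot v v :=
  ⟨hv, Near.refl _ (N.mem_verts_of_condAt hv)⟩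

lemma IsFoot.eq (hv : N.condAt v ≠ 0) (h : N.IsFoot v a) : v = a := by
  have := h.2
  rw [height_eq_zero hv] at this
  exact (near_zero.1 this).2

lemma coreDiam_mono (h : k ≤ l) : N.coreDiam D k v ≤ N.coreDiam D l v := by
  classical
  refine ENNReal.tsum_le_tsum fun x => ENNReal.tsum_le_tsum fun y => ?_
  by_cases hx : N.Near k v x
  · by_cases hy : N.Near k v y
    · rw [if_pos hx, if_pos hy, if_pos (hx.mono h), if_pos (hy.mono h)]
    · rw [if_pos hx, if_neg hy]; exact zero_le
  · rw [if_neg hx]; exact zero_le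

lemma le_coreDiam (hx : N.Near k v a) (hy : N.Near k v b) (ha : N.condAt a ≠ 0)
    (hb : N.condAt b ≠ 0) : D N a b ≤ N.coreDiam D k v := by
  classical
  refine le_trans ?_ ((ENNReal.le_tsum b).trans (ENNReal.le_tsum a))
  rw [if_pos hx, if_pos hy, if_pos (pos_iff_ne_zero.2 ha), if_pos (pos_iff_ne_zero.2 hb)]

lemma coreDiam_ne_top (hfin : ∀ x y, N.condAt x ≠ 0 → N.condAt y ≠ 0 → D N x y ≠ ∞) :
    N.coreDiam D k v ≠ ∞ := by
  classical
  rw [coreDiam, tsum_eq_sum (s := (N.finite_near k v).toFinset) fun x hx => ?_]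
  · refine ENNReal.sum_ne_top.2 fun x _ => ?_
    rw [tsum_eq_sum (s := (N.finite_near k v).toFinset) fun y hy => ?_]
    · refine ENNReal.sum_ne_top.2 fun y _ => ?_
      split_ifs with h1 h2 h3 h4
      · exact hfin x y h3.ne' h4.ne'
      all_goals exact ENNReal.zero_ne_top
    · simp only [Set.Finite.mem_toFinset, Set.mem_ofPred_eq] at hy
      simp [hy]
  · simp only [Set.Finite.mem_toFinset, Set.mem_ofPred_eq] at hx
    simp [hx]

lemma le_detour : ((2 * N.height v) ^ m : ℕ) + N.coreDiam D (N.height v + 2) v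
    ≤ N.detour D m v := by
  classical
  refine le_iInf fun k => ?_
  split_ifs with h
  · have hk : N.height v ≤ k := Nat.sInf_le h.ne'
    refine add_le_add ?_ (coreDiam_mono (by omega))
    exact Nat.cast_le.2 (Nat.pow_le_pow_left (by omega) m)
  · exact le_top

lemma detour_ne_top (hfin : ∀ x y, N.condAt x ≠ 0 → N.condAt y ≠ 0 → D N x y ≠ ∞)
    (ha : N.IsFoot v a) : N.detour D m v ≠ ∞ := by
  classical
  refine ne_top_of_le_ne_top ?_ (iInf_le _ (N.height v))
  rw [if_pos (pos_iff_ne_zero.2 (nvol_ne_zero.2 ⟨a, ha⟩))]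
  exact ENNReal.add_ne_top.2 ⟨ENNReal.natCast_ne_top _, coreDiam_ne_top hfin⟩

lemma edgeLength_ne_top (hfin : ∀ x y, N.condAt x ≠ 0 → N.condAt y ≠ 0 → D N x y ≠ ∞)
    (ha : N.IsFoot v a) (hb : N.IsFoot w b) : N.edgeLength D m v w ≠ ∞ := by
  classical
  rw [edgeLength]
  split_ifs with h
  · have hv : N.condAt v ≠ 0 := (h.trans_le (N.cond_le_condAt v w)).ne'
    have hw : N.condAt w ≠ 0 := (h.trans_le (N.cond_le_condAt_right v w)).ne'
    exact (max_lt (hfin v w hv hw).lt_top (hfin w v hw hv).lt_top).ne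
  · exact ENNReal.add_ne_top.2 ⟨detour_ne_top hfin ha, detour_ne_top hfin hb⟩

lemma dist_foot_le_edgeLength (he : s(v, w) ∈ N.edges) (ha : N.IsFoot v a)
    (hb : N.IsFoot w b) : D N a b ≤ N.edgeLength D m v w := by
  classical
  rw [edgeLength]
  split_ifs with h
  · have hv : N.condAt v ≠ 0 := (h.trans_le (N.cond_le_condAt v w)).ne'
    have hw : N.condAt w ≠ 0 := (h.trans_le (N.cond_le_condAt_right v w)).ne'
    rw [← ha.eq hv, ← hb.eq hw]
    exact le_max_left _ _
  · have h1 := near_one_of_edge he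
    have h2 : N.height w ≤ 1 + N.height v := height_le ha.1 (h1.symm.trans ha.2)
    calc D N a b ≤ N.coreDiam D (N.height v + 2) v :=
          le_coreDiam (ha.2.mono (by omega)) ((h1.trans hb.2).mono (by omega)) ha.1 hb.1
      _ ≤ N.detour D m v := le_add_self.trans le_detour
      _ ≤ _ := le_self_add

lemma height_le_edgeLength (hm : m ≠ 0) :
    ((2 * N.height w) ^ m : ℕ) ≤ N.edgeLength D m v w := by
  classical
  rw [edgeLength]
  split_ifs with h
  · have hw : N.condAt w ≠ 0 := (h.trans_le (N.cond_le_condAt_right v w)).ne'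
    simp [height_eq_zero hw, hm]
  · exact (le_self_add.trans le_detour).trans le_add_self

/-- The walk is projected to its feet: each edge is at least as long as the distance between the
feet of its ends, so the triangle inequality bounds the projected walk. Separately, the length of an
edge pays for the height of its end. -/
lemma exists_isFoot_le_length [MeasurableSpace Ξ] (hD : NaturalDist D) (hm : m ≠ 0)
    (hfin : ∀ x y, N.condAt x ≠ 0 → N.condAt y ≠ 0 → D N x y ≠ ∞)
    (p : N.graph.Walk v w) (ha : N.IsFoot v a) :
    (∃ b, N.IsFoot w b ∧ D N a b ≤ ((p.edges.map (N.edgeWeight D m)).sum : ℝ≥0)) ∧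
      (((2 * N.height w) ^ m : ℕ) : ℝ≥0∞) ≤
        max (((p.edges.map (N.edgeWeight D m)).sum : ℝ≥0) : ℝ≥0∞) ((2 * N.height v) ^ m : ℕ) := by
  induction p generalizing a with
  | nil => exact ⟨⟨a, ha, by simp [hD.self]⟩, le_max_right _ _⟩
  | @cons v u w hvu q ih =>
    have he : s(v, u) ∈ N.edges := by
      rw [graph, SimpleGraph.fromEdgeSet_adj] at hvu
      exact hvu.1
    obtain ⟨c, hc⟩ := exists_isFoot ha.1 (N.mem_right_of_edge he)
    obtain ⟨⟨b, hb, hcb⟩, hh⟩ := ih hc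
    have hlen : ((((SimpleGraph.Walk.cons hvu q).edges.map (N.edgeWeight D m)).sum : ℝ≥0) : ℝ≥0∞)
        = N.edgeLength D m v u + ((q.edges.map (N.edgeWeight D m)).sum : ℝ≥0) := by
      rw [SimpleGraph.Walk.edges_cons, List.map_cons, List.sum_cons, ENNReal.coe_add,
        edgeWeight_mk, ENNReal.coe_toNNReal (edgeLength_ne_top hfin ha hc)]
    rw [hlen]
    refine ⟨⟨b, hb, (hD.triangle N a c b).trans (add_le_add ?_ hcb)⟩, ?_⟩
    · exact dist_foot_le_edgeLength he ha hc
    · refine hh.trans (max_le ?_ ?_)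
      · exact le_self_add.trans (by rw [add_comm]; exact le_max_left _ _)
      · exact ((height_le_edgeLength hm).trans le_self_add).trans (le_max_left _ _)

/-- The endpoint w of a walk leaving the R-ball has either height at least R/2, and then the power
term alone gives R^m, or a foot outside the ball of radius R/2, where the lower bound on D applies.
-/
lemma le_weightDist_attach [MeasurableSpace Ξ] (hD : NaturalDist D) (hm : m ≠ 0)
    (hfin : ∀ x y, N.condAt x ≠ 0 → N.condAt y ≠ 0 → D N x y ≠ ∞) (hx : N.condAt x ≠ 0)
    {R : ℕ} {B : ℝ≥0∞} (hB : B ≤ (R ^ m : ℕ))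
    (h : ∀ b, N.condAt b ≠ 0 → ¬ N.Near (R / 2) x b → B ≤ D N x b) :
    B ≤ (N.attach fun N => N.edgeWeight D m).weightDist x
      ((N.attach fun N => N.edgeWeight D m).ballCompl x R) := by
  refine le_iInf fun w => le_iInf fun hw => le_iInf fun p => ?_
  have hw' : ¬ N.Near R x w := fun hn => hw.2 <| by
    have := (mem_ball_iff (N := N) (N.mem_verts_of_condAt hx) (Nat.cast_nonneg R)).2
      (by rwa [Nat.floor_natCast])
    exact this
  obtain ⟨⟨b, hb, hxb⟩, hh⟩ :=
    exists_isFoot_le_length (N := N) hD hm hfin p (isFoot_self hx)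
  rw [height_eq_zero hx, mul_zero, zero_pow hm, Nat.cast_zero, max_eq_left zero_le] at hh
  by_cases hR : R ≤ 2 * N.height w
  · refine (hB.trans ?_).trans hh
    exact Nat.cast_le.2 (Nat.pow_le_pow_left hR m)
  · refine (h b hb.1 fun hn => hw' ?_).trans hxb
    exact (hn.trans hb.2.symm).mono (by omega)

end Network

variable [MeasurableSpace Ξ] {D : Network Ξ → ℕ → ℕ → ℝ≥0∞}

lemma Natural.max {F G : Network Ξ → (ℕ → ℕ) → ℝ≥0∞} (hF : Natural F) (hG : Natural G) :
    Natural fun N e => max (F N e) (G N e) :=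
  ⟨fun e => (hF.meas e).max (hG.meas e), fun N N' φ e => by rw [hF.inv N N' φ, hG.inv N N' φ]⟩

lemma Natural.ite_lt {A B F G : Network Ξ → (ℕ → ℕ) → ℝ≥0∞} (hA : Natural A) (hB : Natural B)
    (hF : Natural F) (hG : Natural G) :
    Natural fun N e => if A N e < B N e then F N e else G N e := by
  convert Natural.ite (NaturalProp.lt hA hB) hF hG

lemma natural_coreDiam (hD : Natural2 D) (k : ℕ) :
    Natural1 fun (N : Network Ξ) v => N.coreDiam D k v := by
  classical
  refine Natural.tsum_vertex (F := fun N e => ∑' y, if N.Near k (e 1) (e 0) then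
    if N.Near k (e 1) y then if 0 < N.condAt (e 0) then if 0 < N.condAt y then D N (e 0) y
    else 0 else 0 else 0 else 0) ?_ fun N y e hy => ENNReal.tsum_eq_zero.2 fun w =>
      if_neg fun h => hy h.2.1
  exact Natural.tsum_vertex (Natural.ite ((natural_near k).app 2 1)
    (Natural.ite ((natural_near k).app 2 0) (Natural.ite_lt
      (Natural.const 0) (natural_condAt.app 1) (Natural.ite_lt
      (Natural.const 0) (natural_condAt.app 0) (hD.app 1 0) (Natural.const 0))
      (Natural.const 0)) (Natural.const 0)) (Natural.const 0)) fun N y e hy => by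
        have : ¬ N.Near k (push y e 2) (push y e 0) := fun h => hy h.2.1
        simp only [this, if_false, ite_self]

lemma natural_detour (hD : Natural2 D) (m : ℕ) :
    Natural1 fun (N : Network Ξ) v => N.detour D m v := by
  classical
  exact Natural.iInf fun k => Natural.ite_lt
    (Natural.const 0) ((natural_nvol k).app 0)
    ((Natural.const _).add ((natural_coreDiam hD (k + 2)).app 0)) (Natural.const ∞)

lemma natural_edgeLength (hD : Natural2 D) (m : ℕ) :
    Natural2 fun (N : Network Ξ) v w => N.edgeLength D m v w := by
  classical
  exact Natural.ite_lt (Natural.const 0) (Natural.cond 0 1)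
    ((hD.app 0 1).max (hD.app 1 0)) (((natural_detour hD m).app 0).add
      ((natural_detour hD m).app 1))

lemma measurable_edgeWeight (hD : Natural2 D) (m : ℕ) (e : Sym2 ℕ) :
    Measurable fun N : Network Ξ => N.edgeWeight D m e := by
  induction e with
  | _ v w => exact ((natural_edgeLength hD m).meas' v w).ennreal_toNNReal

lemma edgeWeight_inv (hD : Natural2 D) (m : ℕ) (N N' : Network Ξ) (φ : N.Iso N')
    (x y : N.verts) : N.edgeWeight D m s((x : ℕ), (y : ℕ)) =
      N'.edgeWeight D m s((φ.toEquiv x : ℕ), (φ.toEquiv y : ℕ)) := by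
  rw [Network.edgeWeight_mk, Network.edgeWeight_mk, (natural_edgeLength hD m).inv' N N' φ x y]

end EdgeLength

/-! ### Finiteness of the pseudometric -/

section NaturalDist

variable {Ξ : Type*} [MeasurableSpace Ξ] {D : Network Ξ → ℕ → ℕ → ℝ≥0∞}
  {μ : Measure (RootedNetwork Ξ)}

lemma natural_meanSq (hD : Natural2 D) :
    Natural1 fun (N : Network Ξ) x => ∑' w, N.trans x w * D N x w ^ 2 :=
  Natural.tsum_vertex ((natural_trans.app 1 0).mul ((hD.app 1 0).pow 2)) fun N _ _ hy =>
    mul_eq_zero_of_left (N.trans_eq_zero_of_notMem hy) _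

lemma Network.dist_ne_top (hD : NaturalDist D) {N : Network Ξ} (hN : N.PosConnected)
    (h : ∀ x, N.condAt x ≠ 0 → ∑' w, N.trans x w * D N x w ^ 2 ≠ ∞) {x y : ℕ}
    (hx : N.condAt x ≠ 0) (hy : N.condAt y ≠ 0) : D N x y ≠ ∞ := by
  obtain ⟨p⟩ := hN x y (pos_iff_ne_zero.2 hx) (pos_iff_ne_zero.2 hy)
  clear hy
  induction p with
  | nil => simp [hD.self]
  | @cons u v w huv q ih =>
    rw [SimpleGraph.fromEdgeSet_adj] at huv
    have hc : N.cond s(u, v) ≠ 0 := ne_of_gt huv.1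
    have hv : N.condAt v ≠ 0 := fun h0 => hc
      (by simpa using (N.cond_le_condAt_right u v).trans h0.le)
    refine ne_top_of_le_ne_top (ENNReal.add_ne_top.2 ⟨?_, ih hv⟩) (hD.triangle N u v w)
    intro htop
    refine h u hx (top_le_iff.1 (le_trans ?_ (ENNReal.le_tsum v)))
    rw [htop, ENNReal.top_pow two_ne_zero, ENNReal.mul_top (N.trans_ne_zero hc)]

/-- By mass transport, a property that almost surely holds at the root almost surely holds at all
vertices of positive conductance. Here it is finiteness of the mean square step, which makes D
finite on edges of positive conductance and hence along paths of such edges. -/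
lemma IsReversible.ae_dist_ne_top (hμ : IsReversible μ) (hconn : ∀ᵐ N ∂μ, N.PosConnected)
    (hD : NaturalDist D)
    (hL2 : ∫⁻ N, ∑' w, N.trans N.root w * D N.toNetwork N.root w ^ 2 ∂μ ≠ ∞) :
    ∀ᵐ N ∂μ, ∀ x y, N.condAt x ≠ 0 → N.condAt y ≠ 0 → D N.toNetwork x y ≠ ∞ := by
  classical
  have hF := natural_meanSq hD.natural
  have hbad : NaturalProp1 fun (N : Network Ξ) x => ∞ ≤ ∑' w, N.trans x w * D N x w ^ 2 :=
    NaturalProp.le (Natural.const ∞) (hF.app 0)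
  set B : Network Ξ → ℕ → ℝ≥0∞ := fun N y =>
    if ∞ ≤ ∑' w, N.trans y w * D N y w ^ 2 then 1 else 0
  have hf : Natural2 fun (N : Network Ξ) (_ y : ℕ) => B N y := by
    unfold Natural2
    convert Natural.ite (hbad.app 1) (Natural.const 1) (Natural.const 0)
  have h1 : ∫⁻ N, ∑' y, N.condAt y * B N.toNetwork y ∂μ = 0 := by
    rw [hμ.mass_transport hconn hf]
    refine lintegral_eq_zero_of_ae_eq_zero ?_
    filter_upwards [ae_lt_top hF.measurable_at_root hL2] with N hN
    simp [B, hN.ne]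
  have hm : Natural1 fun (N : Network Ξ) _ => ∑' y, N.condAt y * B N y :=
    Natural.tsum_vertex ((natural_condAt.app 0).mul (hf.app 0 0)) fun N _ _ hy =>
      mul_eq_zero_of_left (N.condAt_eq_zero_of_notMem hy) _
  rw [lintegral_eq_zero_iff hm.measurable_at_root] at h1
  filter_upwards [h1, hconn] with N hN hc x y hx hy
  refine Network.dist_ne_top hD hc (fun z hz htop => ?_) hx hy
  have := ENNReal.tsum_eq_zero.1 hN z
  simp [B, htop, hz] at this

end NaturalDist

/-! ### From a pseudometric to a reversible edge weight -/

section Main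

variable {D : Network Unit → ℕ → ℕ → ℝ≥0∞} {μ : Measure (RootedNetwork Unit)}

lemma withMark_eq_self {Ξ : Type*} {N : RootedNetwork Ξ} {f : Sym2 ℕ → Ξ} (h : f = N.mark) :
    ({ N with mark := f } : RootedNetwork Ξ) = N := by
  subst h
  rfl

lemma measurable_forget {Ξ : Type*} [MeasurableSpace Ξ] :
    Measurable (RootedNetwork.forget : RootedNetwork Ξ → RootedNetwork Unit) :=
  measurable_rooted_attach (W := fun _ _ => ()) fun _ => measurable_const

/-- P need not be measurable, so the statement is pulled back along `forget`, which undoes `attach`.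
Almost surely the mark equals the computed one, as this is a measurable condition on each of
countably many edges. -/
lemma ae_map_attach {W : Network Unit → Sym2 ℕ → ℝ≥0} (hW : ∀ e, Measurable fun N => W N e)
    {P : RootedNetwork ℝ≥0 → Prop} (h : ∀ᵐ N ∂μ, P (N.attach W)) :
    ∀ᵐ N ∂(μ.map (RootedNetwork.attach W)), P N := by
  have hmap : (μ.map (RootedNetwork.attach W)).map RootedNetwork.forget = μ := by
    rw [Measure.map_map measurable_forget (measurable_rooted_attach hW)]
    exact Measure.map_id
  have h1 : ∀ᵐ N ∂(μ.map (RootedNetwork.attach W)), P (N.forget.attach W) := by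
    rw [← hmap] at h
    exact ae_of_ae_map measurable_forget.aemeasurable h
  have h2 : ∀ᵐ N ∂(μ.map (RootedNetwork.attach W)), ∀ e, N.mark e = W N.forget.toNetwork e := by
    rw [ae_all_iff]
    intro e
    rw [ae_map_iff (measurable_rooted_attach hW).aemeasurable]
    · exact ae_of_all _ fun N => rfl
    · exact measurableSet_eq_fun ((measurable_mark e).comp measurable_toNetwork)
        ((hW e).comp (measurable_toNetwork.comp measurable_forget))
  filter_upwards [h1, h2] with N hN hm
  have : N.forget.attach W = N := withMark_eq_self (funext hm).symm
  rwa [this] at hN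

/-- A reversible edge weight whose path metric dominates a given invariant pseudometric. -/
theorem IsReversible.exists_edgeWeight (hμ : IsReversible μ) (hconn : ∀ᵐ N ∂μ, N.PosConnected)
    (hD : NaturalDist D)
    (hL2 : ∫⁻ N, ∑' w, N.trans N.root w * D N.toNetwork N.root w ^ 2 ∂μ < ∞) {s : ℝ}
    (hlow : ∀ᵐ N ∂μ, ∀ᶠ R : ℕ in atTop, ∀ b, N.condAt b ≠ 0 → ¬ N.Near (R / 2) N.root b →
      ENNReal.ofReal ((R : ℝ) ^ (s / 2)) ≤ D N.toNetwork N.root b) :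
    ∃ ν : Measure (RootedNetwork ℝ≥0), ν.map RootedNetwork.forget = μ ∧ IsReversible ν ∧
      ∫⁻ q, (q.1.mark s(q.2.1, q.2.2) : ℝ≥0∞) ^ 2 ∂(stepLaw ν) < ∞ ∧
      ∀ᵐ N ∂ν, ∀ᶠ R : ℕ in atTop, ENNReal.ofReal ((R : ℝ) ^ (s / 2)) ≤
        N.weightDist N.root (N.ballCompl N.root R) := by
  -- The exponent makes R^m at least R^(s/2), and m ≠ 0 makes height 0 cost nothing.
  obtain ⟨m, hm⟩ : ∃ m : ℕ, m ≠ 0 ∧ s / 2 ≤ m := by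
    obtain ⟨m, hm⟩ := exists_nat_ge (s / 2)
    exact ⟨m + 1, m.succ_ne_zero, hm.trans (by push_cast; linarith)⟩
  set W : Network Unit → Sym2 ℕ → ℝ≥0 := fun N => N.edgeWeight D m with hWdef
  have hW : ∀ e, Measurable fun N => W N e := measurable_edgeWeight hD.natural m
  refine ⟨μ.map (RootedNetwork.attach W), ?_, hμ.attach hW fun N N' φ x y _ =>
    edgeWeight_inv hD.natural m N N' φ x y, ?_, ae_map_attach hW ?_⟩
  · rw [Measure.map_map measurable_forget (measurable_rooted_attach hW)]
    exact Measure.map_id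
  · have hmark : Measurable fun q : Network ℝ≥0 × ℕ × ℕ =>
        (q.1.mark s(q.2.1, q.2.2) : ℝ≥0∞) ^ 2 :=
      measurable_uncurry₂ (f := fun (N : Network ℝ≥0) x y => (N.mark s(x, y) : ℝ≥0∞) ^ 2)
        fun x y => (measurable_mark s(x, y)).coe_nnreal_ennreal.pow_const 2
    rw [lintegral_stepLaw_attach hW μ hmark, lintegral_stepLaw μ (f := fun q =>
      ((q.1.attach W).mark s(q.2.1, q.2.2) : ℝ≥0∞) ^ 2) (hmark.comp
        (((measurable_attach hW).comp measurable_fst).prodMk measurable_snd))]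
    refine lt_of_le_of_lt (lintegral_mono fun N => ENNReal.tsum_le_tsum fun w => ?_) hL2
    -- Edges of zero conductance have transition probability 0, so their artificial lengths do not
    -- enter the second moment.
    by_cases hc : N.cond s(N.root, w) = 0
    · have : N.trans N.root w = 0 := by simp [Network.trans, hc]
      rw [this, zero_mul, zero_mul]
    · gcongr
      change (((N.edgeLength D m N.root w).toNNReal : ℝ≥0) : ℝ≥0∞) ≤ _
      refine ENNReal.coe_toNNReal_le_self.trans ?_
      rw [Network.edgeLength, if_pos (by simpa [pos_iff_ne_zero] using hc), hD.symm _ w, max_self]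
  · filter_upwards [hμ.condAt_root_pos, hlow, hμ.ae_dist_ne_top hconn hD hL2.ne]
      with N hN hl hfin
    filter_upwards [hl, eventually_ge_atTop 1] with R hR hR1
    refine Network.le_weightDist_attach hD hm.1 hfin hN.ne' ?_ hR
    rw [← ENNReal.ofReal_natCast]
    refine ENNReal.ofReal_le_ofReal ?_
    rw [Nat.cast_pow, ← Real.rpow_natCast]
    exact Real.rpow_le_rpow_of_exponent_le (by exact_mod_cast hR1) hm.2

end Main

/-! ### Summing over scales -/

section MultiScale

variable {Ξ : Type*} {ι : Type*}

/-- A weighted sum of the distances of countably many scales. -/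
noncomputable def Network.multiDist (S : ι → Scale) (r : ι → ℕ) (α β : ι → ℝ≥0∞)
    (N : Network Ξ) (x y : ℕ) : ℝ≥0∞ :=
  ∑' i, α i * (β i * N.scaleDist (S i) (r i) x y)

variable [MeasurableSpace Ξ] [Countable ι] {S : ι → Scale} {r : ι → ℕ} {α β : ι → ℝ≥0∞}

lemma naturalDist_multiDist :
    NaturalDist (Network.multiDist (Ξ := Ξ) S r α β) where
  natural := Natural.tsum fun i => (Natural.const _).mul ((Natural.const _).mul
    ((natural_scaleDist (S i) (r i)).app 0 1))
  self N x := by simp [Network.multiDist, Network.scaleDist, absDiff_self]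
  symm N x y := by simp only [Network.multiDist, Network.scaleDist, absDiff_comm]
  triangle N x y z := by
    simp only [Network.multiDist, Network.scaleDist]
    rw [← ENNReal.tsum_add]
    refine ENNReal.tsum_le_tsum fun i => ?_
    rw [← mul_add, ← mul_add, ← ENNReal.tsum_add]
    gcongr
    rw [← mul_add]
    gcongr
    exact absDiff_triangle _ _ _

/-- Cauchy-Schwarz with the summable weights α reduces the second moment of the sum to the
individual ones, which β stretches to at most C. -/
lemma IsReversible.lintegral_sq_multiDist_lt {μ : Measure (RootedNetwork Ξ)}
    [IsProbabilityMeasure μ] (hμ : IsReversible μ) (hconn : ∀ᵐ N ∂μ, N.PosConnected)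
    (hU : ∀ i, (S i).U ≠ ∞) (hq : ∀ i, (S i).q ≤ (S i).R) (htr : ∀ i, (S i).t ≤ r i)
    (hr : ∀ i, r i ≤ (S i).R) (hR : ∀ i, 2 ≤ (S i).R) (hα : ∑' i, α i ≠ ∞) {C : ℝ≥0∞}
    (hC : C ≠ ∞) (hβ : ∀ i, β i ^ 2 * ((S i).U * (S i).L⁻¹ * ((S i).E * (S i).L⁻¹)) ≤ C) :
    ∫⁻ N, ∑' w, N.trans N.root w *
      Network.multiDist S r α β N.toNetwork N.root w ^ 2 ∂μ < ∞ := by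
  have hm : ∀ i, Measurable fun N : RootedNetwork Ξ =>
      ∑' w, N.trans N.root w * N.scaleDist (S i) (r i) N.root w ^ 2 := fun i =>
    (natural_meanSq (natural_scaleDist (S i) (r i))).measurable_at_root
  calc ∫⁻ N, ∑' w, N.trans N.root w *
        Network.multiDist S r α β N.toNetwork N.root w ^ 2 ∂μ
      ≤ ∫⁻ N, ∑' w, N.trans N.root w * ((∑' i, α i) *
        ∑' i, α i * (β i * N.scaleDist (S i) (r i) N.root w) ^ 2) ∂μ := by
        gcongr
        exact sq_tsum_mul_le _ _
    _ = ∫⁻ N, (∑' i, α i) * ∑' i, α i * β i ^ 2 *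
        ∑' w, N.trans N.root w * N.scaleDist (S i) (r i) N.root w ^ 2 ∂μ := by
        refine lintegral_congr fun N => ?_
        simp_rw [mul_left_comm _ (∑' i, α i)]
        rw [ENNReal.tsum_mul_left]
        congr 1
        simp_rw [← ENNReal.tsum_mul_left]
        rw [ENNReal.tsum_comm]
        exact tsum_congr fun i => tsum_congr fun w => by ring
    _ = (∑' i, α i) * ∑' i, α i * β i ^ 2 *
        ∫⁻ N, ∑' w, N.trans N.root w * N.scaleDist (S i) (r i) N.root w ^ 2 ∂μ := by
        rw [lintegral_const_mul _ (Measurable.tsum fun i => (hm i).const_mul _),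
          lintegral_tsum fun i => ((hm i).const_mul _).aemeasurable]
        simp_rw [lintegral_const_mul _ (hm _)]
    _ ≤ (∑' i, α i) * ∑' i, α i * C := by
        refine mul_le_mul' le_rfl (ENNReal.tsum_le_tsum fun i => ?_)
        rw [mul_assoc]
        refine mul_le_mul' le_rfl (le_trans ?_ (hβ i))
        gcongr
        exact hμ.lintegral_sq_scaleDist_le hconn (hU i) (hq i) (htr i) (hr i) (hR i)
    _ < ∞ := by
        rw [ENNReal.tsum_mul_right]
        exact ENNReal.mul_lt_top hα.lt_top (ENNReal.mul_lt_top hα.lt_top hC.lt_top)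

end MultiScale

/-! ### A radius with controlled volume growth -/

section Coverage

variable {Ξ : Type*} {N : Network Ξ} {S : Scale}

lemma exists_le_mul_of_lt_pow {V : ℕ → ℝ≥0∞} {K : ℝ≥0∞} {J : ℕ} (h : V J < K ^ J * V 0) :
    ∃ j < J, V (j + 1) ≤ K * V j := by
  by_contra! hc
  have : ∀ j ≤ J, K ^ j * V 0 ≤ V j := by
    intro j
    induction j with
    | zero => simp
    | succ j ih =>
      intro hj
      calc K ^ (j + 1) * V 0 = K * (K ^ j * V 0) := by ring
        _ ≤ K * V j := by gcongr; exact ih (by omega)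
        _ ≤ V (j + 1) := (hc j (by omega)).le
  exact absurd (this J le_rfl) (not_le.2 h)

/-- A good vertex is separated from the complement of a ball, at one of the radii `2 ^ j * t`. -/
lemma Network.Good.exists_inv_le_scaleDist {x : ℕ} (hg : N.Good S x) (hU : S.U ≠ ∞)
    (hq : S.q ≤ S.R) {K : ℝ≥0∞} {J : ℕ} (hJq : 2 ^ J * S.t ≤ S.q)
    (hK : S.U < K ^ J * N.condAt x) :
    ∃ j < J, ∀ y, ¬ N.Near (2 * S.R) x y →
      K⁻¹ ≤ N.scaleDist S (2 ^ j * S.t) x y := by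
  have hle : ∀ j ≤ J, N.goodVol S (2 * (2 ^ j * S.t)) x ≤ S.U := fun j hj =>
    (goodVol_le_nvol.trans (N.nvol_mono x (by
      have : 2 ^ j * S.t ≤ 2 ^ J * S.t :=
        Nat.mul_le_mul_right _ (Nat.pow_le_pow_right (by norm_num) hj)
      omega))).trans hg.1.1.2
  -- The good volumes at the radii 2 · 2^j t start above c_x and stay below U < K^J c_x, so some
  -- doubling multiplies them by at most K.
  obtain ⟨j, hj, hVj⟩ := exists_le_mul_of_lt_pow
    (V := fun j => N.goodVol S (2 * (2 ^ j * S.t)) x) (K := K) (J := J)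
    (lt_of_le_of_lt (hle J le_rfl) (hK.trans_le (by gcongr; exact hg.condAt_le_goodVol)))
  refine ⟨j, hj, fun y hy => le_trans ?_ (goodVol_mul_inv_le_scaleDist hq ?_ hy)⟩
  · have h4 : 4 * (2 ^ j * S.t) = 2 * (2 ^ (j + 1) * S.t) := by ring
    have h0 : N.goodVol S (2 * (2 ^ j * S.t)) x ≠ 0 :=
      (hg.1.1.1.trans_le hg.condAt_le_goodVol).ne'
    have htop : N.goodVol S (2 * (2 ^ j * S.t)) x ≠ ∞ :=
      ((hle j hj.le).trans_lt hU.lt_top).ne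
    rw [h4, ← div_eq_mul_inv, ENNReal.le_div_iff_mul_le (Or.inr h0) (Or.inr htop), mul_comm]
    refine ENNReal.div_le_of_le_mul' ?_
    simpa [mul_comm] using hVj
  · calc 2 * (2 ^ j * S.t) = 2 ^ (j + 1) * S.t := by ring
      _ ≤ 2 ^ J * S.t := Nat.mul_le_mul_right _ (Nat.pow_le_pow_right (by norm_num) hj)
      _ ≤ S.q := hJq

end Coverage

/-! ### Choice of the parameters -/

section Parameters

lemma two_pow_rpow (k : ℕ) (x : ℝ) : ((2 ^ k : ℕ) : ℝ) ^ x = 2 ^ ((k : ℝ) * x) := by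
  rw [Nat.cast_pow, Nat.cast_ofNat, ← Real.rpow_natCast, ← Real.rpow_mul zero_le_two]

lemma ofReal_two_rpow_mul (x y : ℝ) :
    ENNReal.ofReal (2 ^ x) * ENNReal.ofReal (2 ^ y) = ENNReal.ofReal (2 ^ (x + y)) := by
  rw [Real.rpow_add two_pos, ENNReal.ofReal_mul (by positivity)]

lemma ofReal_two_rpow_inv (x : ℝ) :
    (ENNReal.ofReal (2 ^ x))⁻¹ = ENNReal.ofReal (2 ^ (-x)) := by
  rw [Real.rpow_neg zero_le_two, ENNReal.ofReal_inv_of_pos (by positivity)]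

lemma ofReal_two_rpow_pow (x : ℝ) (k : ℕ) :
    ENNReal.ofReal (2 ^ x) ^ k = ENNReal.ofReal (2 ^ (k * x)) := by
  rw [← ENNReal.ofReal_pow (by positivity), ← Real.rpow_mul_natCast zero_le_two, mul_comm]

lemma ofReal_two_rpow_le {x y : ℝ} (h : x ≤ y) :
    ENNReal.ofReal (2 ^ x) ≤ ENNReal.ofReal (2 ^ y) :=
  ENNReal.ofReal_le_ofReal (Real.rpow_le_rpow_of_exponent_le one_le_two h)

/-- The scale at radius `2 ^ n`, for networks whose lower volume, upper volume and resistance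
exponents are `a`, `b` and `z`, up to `η`. -/
noncomputable def dyadicScale (η a b z : ℝ) (n : ℕ) : Scale where
  q := ⌊((2 ^ n : ℕ) : ℝ) ^ (1 - η)⌋₊
  R := 2 ^ n
  t := 2 ^ ⌊(1 - 2 * η) * n⌋₊
  U := ENNReal.ofReal (((2 ^ (n + 2) : ℕ) : ℝ) ^ (b + η))
  L := ENNReal.ofReal (((2 ^ ⌊(1 - 2 * η) * n⌋₊ : ℕ) : ℝ) ^ (a - η))
  E := 2 * (ENNReal.ofReal (((2 ^ n : ℕ) : ℝ) ^ (z - η)))⁻¹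

variable {Ξ : Type*} {η a b z s : ℝ}

lemma dyadicScale_q_le (hη : 0 ≤ η) (n : ℕ) :
    (dyadicScale η a b z n).q ≤ (dyadicScale η a b z n).R := by
  refine Nat.floor_le_of_le ?_
  calc ((2 ^ n : ℕ) : ℝ) ^ (1 - η) ≤ ((2 ^ n : ℕ) : ℝ) ^ (1 : ℝ) :=
        Real.rpow_le_rpow_of_exponent_le (by exact_mod_cast Nat.one_le_two_pow) (by linarith)
    _ = ((2 ^ n : ℕ) : ℝ) := Real.rpow_one _

/-- The radii t ≈ 2^((1-2η)n) and q ≈ 2^((1-η)n) leave room for ηn doublings; half of these are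
used. -/
lemma dyadicScale_pow_mul_t_le (hη : 0 ≤ η) (hη' : η ≤ 1 / 2) {n j : ℕ}
    (hj : j ≤ ⌊η * n / 2⌋₊) : 2 ^ j * (dyadicScale η a b z n).t ≤ (dyadicScale η a b z n).q := by
  have h1 : (j : ℝ) ≤ η * n / 2 :=
    (Nat.cast_le.2 hj).trans (Nat.floor_le (by positivity))
  have h2 : (⌊(1 - 2 * η) * n⌋₊ : ℝ) ≤ (1 - 2 * η) * n :=
    Nat.floor_le (mul_nonneg (by linarith) (Nat.cast_nonneg n))
  refine Nat.le_floor ?_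
  rw [dyadicScale, ← pow_add, two_pow_rpow, Nat.cast_pow, Nat.cast_ofNat, ← Real.rpow_natCast]
  refine Real.rpow_le_rpow_of_exponent_le one_le_two ?_
  push_cast
  have : 0 ≤ η * n := by positivity
  nlinarith

lemma eventually_good {N : RootedNetwork Ξ} (hc : 0 < N.condAt N.root) (hη : 0 ≤ η)
    (hη' : η < 1 / 2)
    (h1 : ∀ᶠ R : ℕ in atTop, ENNReal.ofReal ((R : ℝ) ^ (a - η)) ≤ N.vol N.root R)
    (h2 : ∀ᶠ R : ℕ in atTop, N.vol N.root R ≤ ENNReal.ofReal ((R : ℝ) ^ (b + η)))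
    (h3 : ∀ᶠ R : ℕ in atTop, ENNReal.ofReal ((R : ℝ) ^ (z - η)) ≤
      N.effRes (N.ball N.root ((R : ℝ) ^ (1 - η))) (N.ballCompl N.root R)) :
    ∀ᶠ n in atTop, N.Good (dyadicScale η a b z n) N.root := by
  have hpow : Tendsto (fun n : ℕ => 2 ^ n) atTop atTop :=
    tendsto_pow_atTop_atTop_of_one_lt one_lt_two
  have hfl : Tendsto (fun n : ℕ => ⌊(1 - 2 * η) * n⌋₊) atTop atTop :=
    tendsto_nat_floor_atTop.comp
      (tendsto_natCast_atTop_atTop.const_mul_atTop (by linarith))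
  have hvol : ∀ R : ℕ, N.vol N.root R = N.nvol R N.root := fun R => by
    rw [Network.vol_eq_nvol N.root_mem (Nat.cast_nonneg R), Nat.floor_natCast]
  filter_upwards [(hpow.comp hfl).eventually h1,
    (hpow.comp (tendsto_add_atTop_nat 2)).eventually h2, hpow.eventually h3] with n h1 h2 h3
  simp only [Function.comp_apply, hvol] at h1 h2
  refine ⟨⟨⟨hc, ?_⟩, h1⟩, ?_⟩
  · have : 4 * (dyadicScale η a b z n).R = 2 ^ (n + 2) := by
      simp only [dyadicScale]; ring
    rw [this]
    exact h2
  · exact Network.potEnergy_le_of_effRes (by positivity) (dyadicScale_q_le hη n) N.root_mem h3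

/-- The weight of the scale `n` in the combined distance is `scaleWeight ε n * scaleFactor`. -/
noncomputable def scaleWeight (ε : ℝ) (n : ℕ) : ℝ≥0∞ := ENNReal.ofReal (2 ^ (-(ε * n)))

/-- The factor by which distances of the scale `n` are stretched, relative to `scaleWeight`. -/
noncomputable def scaleFactor (ε s M : ℝ) (n : ℕ) : ℝ≥0∞ :=
  ENNReal.ofReal (2 ^ (M + 2 * |s| + ε * n + n * (s / 2)))

/-- With at most n radii at scale n, the sum is dominated by that of n 2^(-εn). -/
lemma tsum_scaleWeight_ne_top {ε : ℝ} (hε : 0 < ε) {J : ℕ → ℕ} (hJ : ∀ n, J n ≤ n) :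
    ∑' i : Σ n, Fin (J n), scaleWeight ε i.1 ≠ ∞ := by
  set x : ℝ := 2 ^ (-ε) with hx
  have hx0 : 0 < x := by positivity
  have hx1 : x < 1 := Real.rpow_lt_one_of_one_lt_of_neg one_lt_two (by linarith)
  have hs : Summable fun n : ℕ => (n : ℝ) ^ 1 * x ^ n :=
    summable_pow_mul_geometric_of_norm_lt_one 1 (by rwa [Real.norm_of_nonneg hx0.le])
  refine ne_top_of_le_ne_top hs.tsum_ofReal_ne_top ?_
  rw [ENNReal.tsum_sigma' (f := fun i : Σ n, Fin (J n) => scaleWeight ε i.1)]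
  refine ENNReal.tsum_le_tsum fun n => ?_
  rw [tsum_fintype]
  change ∑ _ : Fin (J n), scaleWeight ε n ≤ _
  rw [Finset.sum_const, Finset.card_univ, Fintype.card_fin, nsmul_eq_mul, pow_one,
    ENNReal.ofReal_mul (Nat.cast_nonneg n), ENNReal.ofReal_natCast, scaleWeight]
  refine mul_le_mul' (Nat.cast_le.2 (hJ n)) (le_of_eq ?_)
  rw [hx, ← Real.rpow_mul_natCast zero_le_two, neg_mul]

/-- In the exponent of 2 the coefficient of n is the left side of `hexp`. The constants left over
come from M and |s| in the factor, from the radius 2^(n+2) in U, and from the rounding of t, which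
enters twice through L. -/
lemma scaleFactor_sq_mul_le {ε M : ℝ} (hη' : η ≤ 1 / 2)
    (hexp : 2 * ε + s + b + 2 * η - z - 2 * (1 - 2 * η) * (a - η) ≤ 0) (n : ℕ) :
    scaleFactor ε s M n ^ 2 * ((dyadicScale η a b z n).U * (dyadicScale η a b z n).L⁻¹ *
      ((dyadicScale η a b z n).E * (dyadicScale η a b z n).L⁻¹)) ≤
      2 * ENNReal.ofReal (2 ^ (2 * M + 4 * |s| + 2 * (b + η) + 2 * |a - η|)) := by
  have e : ∀ u v w l : ℝ≥0∞, v ^ 2 * (u * l * (2 * w * l)) = 2 * (v ^ 2 * u * l * w * l) :=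
    fun u v w l => by ring
  simp only [dyadicScale, scaleFactor, two_pow_rpow, ofReal_two_rpow_inv]
  rw [e]
  simp only [ofReal_two_rpow_pow, ofReal_two_rpow_mul]
  gcongr 2 * ?_
  apply ofReal_two_rpow_le
  have h0 : 0 ≤ (1 - 2 * η) * n := mul_nonneg (by linarith) (Nat.cast_nonneg n)
  have h1 := Nat.floor_le h0
  have h2 := (Nat.lt_floor_add_one ((1 - 2 * η) * n)).le
  set k : ℝ := (⌊(1 - 2 * η) * n⌋₊ : ℝ)
  have h3 : ((1 - 2 * η) * n - k) * (a - η) ≤ |a - η| := by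
    calc ((1 - 2 * η) * n - k) * (a - η) ≤ ((1 - 2 * η) * n - k) * |a - η| :=
          mul_le_mul_of_nonneg_left (le_abs_self _) (by linarith)
      _ ≤ 1 * |a - η| := mul_le_mul_of_nonneg_right (by linarith) (abs_nonneg _)
      _ = |a - η| := one_mul _
  have h4 := mul_nonpos_of_nonpos_of_nonneg hexp (Nat.cast_nonneg (α := ℝ) n)
  push_cast
  nlinarith

/-- With M = 2(|b|+η+1)/η, the product M · ηn/2 is (|b|+η+1)n, which exceeds the exponent of U by at
least n up to a constant. The factor 2^(A-n) gained in this way tends to 0 and so falls below c. -/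
lemma eventually_lt_pow_mul {c : ℝ≥0∞} (hc : c ≠ 0) (hη : 0 < η) :
    ∀ᶠ n : ℕ in atTop, (dyadicScale η a b z n).U <
      ENNReal.ofReal (2 ^ (2 * (|b| + η + 1) / η)) ^ ⌊η * n / 2⌋₊ * c := by
  set M : ℝ := 2 * (|b| + η + 1) / η with hM
  set A : ℝ := M + 2 * (|b| + η)
  have hM0 : 0 ≤ M := by positivity
  have hMη : M * η = 2 * (|b| + η + 1) := by rw [hM]; field_simp
  have hlim : Tendsto (fun n : ℕ => ENNReal.ofReal (2 ^ (A - n))) atTop (nhds 0) := by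
    rw [← ENNReal.ofReal_zero]
    refine ENNReal.tendsto_ofReal ?_
    have : Tendsto (fun n : ℕ => (2 : ℝ) ^ A * (1 / 2 : ℝ) ^ n) atTop (nhds ((2 : ℝ) ^ A * 0)) :=
      (tendsto_pow_atTop_nhds_zero_of_lt_one (by norm_num) (by norm_num)).const_mul _
    rw [mul_zero] at this
    refine this.congr fun n => ?_
    rw [Real.rpow_sub two_pos, Real.rpow_natCast, one_div, inv_pow, div_eq_mul_inv]
  filter_upwards [hlim.eventually (gt_mem_nhds (pos_iff_ne_zero.2 hc))] with n hn
  have h1 := (Nat.lt_floor_add_one (η * n / 2)).le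
  have hb := le_abs_self b
  have hn0 : (0 : ℝ) ≤ n := Nat.cast_nonneg n
  calc (dyadicScale η a b z n).U
      ≤ ENNReal.ofReal (2 ^ M) ^ ⌊η * n / 2⌋₊ * ENNReal.ofReal (2 ^ (A - n)) := by
        simp only [dyadicScale]
        rw [two_pow_rpow, ofReal_two_rpow_pow, ofReal_two_rpow_mul]
        apply ofReal_two_rpow_le
        have h2 : M * (η * n / 2) ≤ M * (⌊η * n / 2⌋₊ + 1) := mul_le_mul_of_nonneg_left h1 hM0
        have h3 : M * (η * n / 2) = (|b| + η + 1) * n := by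
          calc M * (η * n / 2) = M * η * (n / 2) := by ring
            _ = _ := by rw [hMη]; ring
        have h4 : ((n : ℝ) + 2) * (b + η) ≤ (n + 2) * (|b| + η) :=
          mul_le_mul_of_nonneg_left (by linarith) (by linarith)
        push_cast
        simp only [A]
        nlinarith
    _ < _ := by
        refine ENNReal.mul_lt_mul_right ?_ ?_ hn
        · exact pow_ne_zero _ (by simp; positivity)
        · exact ENNReal.pow_ne_top ENNReal.ofReal_ne_top

lemma rpow_le_two_rpow {n R : ℕ} (h1 : 2 ^ (n + 2) ≤ R) (h2 : R < 2 ^ (n + 3)) (s : ℝ) :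
    (R : ℝ) ^ (s / 2) ≤ 2 ^ (2 * |s| + n * (s / 2)) := by
  have hR : (0 : ℝ) < R := by exact_mod_cast (Nat.two_pow_pos (n + 2)).trans_le h1
  have hs := le_abs_self s
  have hs' := neg_abs_le s
  have hs0 := abs_nonneg s
  rcases le_total 0 s with h | h
  · calc (R : ℝ) ^ (s / 2) ≤ ((2 ^ (n + 3) : ℕ) : ℝ) ^ (s / 2) :=
          Real.rpow_le_rpow hR.le (by exact_mod_cast h2.le) (by linarith)
      _ = 2 ^ (((n + 3 : ℕ) : ℝ) * (s / 2)) := two_pow_rpow _ _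
      _ ≤ _ := Real.rpow_le_rpow_of_exponent_le one_le_two (by push_cast; nlinarith)
  · calc (R : ℝ) ^ (s / 2) ≤ ((2 ^ (n + 2) : ℕ) : ℝ) ^ (s / 2) :=
          Real.rpow_le_rpow_of_nonpos (by positivity) (by exact_mod_cast h1) (by linarith)
      _ = 2 ^ (((n + 2 : ℕ) : ℝ) * (s / 2)) := two_pow_rpow _ _
      _ ≤ _ := Real.rpow_le_rpow_of_exponent_le one_le_two (by push_cast; nlinarith)

/-- The combined distance is large on complements of balls around good roots. -/
lemma eventually_le_multiDist {N : RootedNetwork Ξ} {ε : ℝ} (hη : 0 < η) (hη' : η ≤ 1 / 2)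
    (hgood : ∀ᶠ n in atTop, N.Good (dyadicScale η a b z n) N.root) (hc : 0 < N.condAt N.root) :
    ∀ᶠ R : ℕ in atTop, ∀ y, ¬ N.Near (R / 2) N.root y → ENNReal.ofReal ((R : ℝ) ^ (s / 2)) ≤
      Network.multiDist (ι := Σ n : ℕ, Fin ⌊η * n / 2⌋₊) (fun i => dyadicScale η a b z i.1)
        (fun i => 2 ^ (i.2 : ℕ) * (dyadicScale η a b z i.1).t) (fun i => scaleWeight ε i.1)
        (fun i => scaleFactor ε s (2 * (|b| + η + 1) / η) i.1) N.toNetwork N.root y := by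
  obtain ⟨n₀, hn₀⟩ := eventually_atTop.1
    (hgood.and (eventually_lt_pow_mul (a := a) (b := b) (z := z) hc.ne' hη))
  filter_upwards [eventually_ge_atTop (2 ^ (n₀ + 2))] with R hR y hy
  -- The scale is two below the logarithm of R, so that the ball of radius 2 · 2^n lies inside that
  -- of radius R/2.
  obtain ⟨n, hn, h1, h2⟩ : ∃ n, n₀ ≤ n ∧ 2 ^ (n + 2) ≤ R ∧ R < 2 ^ (n + 3) := by
    have hR0 : R ≠ 0 := ((Nat.two_pow_pos _).trans_le hR).ne'
    have hl : n₀ + 2 ≤ Nat.log 2 R := Nat.le_log_of_pow_le (by norm_num) hR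
    refine ⟨Nat.log 2 R - 2, by omega, ?_, ?_⟩
    · rw [Nat.sub_add_cancel (by omega)]
      exact Nat.pow_log_le_self 2 hR0
    · rw [show Nat.log 2 R - 2 + 3 = Nat.log 2 R + 1 by omega]
      exact Nat.lt_pow_succ_log_self (by norm_num) R
  obtain ⟨hg, hlt⟩ := hn₀ n hn
  obtain ⟨j, hj, hjy⟩ := hg.exists_inv_le_scaleDist ENNReal.ofReal_ne_top
    (dyadicScale_q_le hη.le n) (dyadicScale_pow_mul_t_le hη.le hη' le_rfl) hlt
  have hfar : ¬ N.Near (2 * (dyadicScale η a b z n).R) N.root y := fun h => hy (h.mono (by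
    have : 2 ^ (n + 2) = 2 * (2 * 2 ^ n) := by ring
    simp only [dyadicScale]
    omega))
  calc ENNReal.ofReal ((R : ℝ) ^ (s / 2))
      ≤ ENNReal.ofReal (2 ^ (2 * |s| + n * (s / 2))) :=
        ENNReal.ofReal_le_ofReal (rpow_le_two_rpow h1 h2 s)
    _ = scaleWeight ε n * (scaleFactor ε s (2 * (|b| + η + 1) / η) n *
          (ENNReal.ofReal (2 ^ (2 * (|b| + η + 1) / η)))⁻¹) := by
        rw [scaleWeight, scaleFactor, ofReal_two_rpow_inv, ofReal_two_rpow_mul,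
          ofReal_two_rpow_mul]
        congr 2
        ring
    _ ≤ scaleWeight ε n * (scaleFactor ε s (2 * (|b| + η + 1) / η) n *
          N.scaleDist (dyadicScale η a b z n) (2 ^ j * (dyadicScale η a b z n).t) N.root y) := by
        gcongr
        exact hjy y hfar
    _ ≤ _ := ENNReal.le_tsum (f := fun i : Σ n : ℕ, Fin ⌊η * n / 2⌋₊ => scaleWeight ε i.1 *
          (scaleFactor ε s (2 * (|b| + η + 1) / η) i.1 * N.scaleDist (dyadicScale η a b z i.1)
            (2 ^ (i.2 : ℕ) * (dyadicScale η a b z i.1).t) N.root y)) ⟨n, ⟨j, hj⟩⟩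

/-- Since ⊥ absorbs in `EReal` sums, the inequality excludes l = ⊥, u = ⊤ and r = ⊥; any other
infinite value is replaced by a suitably extreme real. If all are finite, moving each by an eighth
of the gap uses up half of it. -/
lemma exists_real_lt_of_lt {t : ℝ} {l u r : EReal} (h : (t : EReal) < 2 * l - u + r) :
    ∃ a b c : ℝ, (a : EReal) < l ∧ u < b ∧ (c : EReal) < r ∧ t < 2 * a - b + c := by
  have e2 : (2 : EReal) = ((2 : ℝ) : EReal) := rfl
  rw [e2] at h
  have hl : l ≠ ⊥ := by
    rintro rfl
    rw [EReal.coe_mul_bot_of_pos two_pos, EReal.bot_sub, EReal.bot_add] at h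
    exact not_lt_bot h
  have hu : u ≠ ⊤ := by
    rintro rfl
    rw [EReal.sub_top, EReal.bot_add] at h
    exact not_lt_bot h
  have hr : r ≠ ⊥ := by
    rintro rfl
    rw [EReal.add_bot] at h
    exact not_lt_bot h
  obtain ⟨b, hb, -⟩ := EReal.exists_between_coe_real (lt_top_iff_ne_top.2 hu)
  obtain ⟨c, -, hc⟩ := EReal.exists_between_coe_real (bot_lt_iff_ne_bot.2 hr)
  induction l with
  | bot => exact absurd rfl hl
  | top => exact ⟨(t + b - c) / 2 + 1, b, c, EReal.coe_lt_top _, hb, hc, by linarith⟩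
  | coe l =>
    have hl1 : ((l - 1 : ℝ) : EReal) < l := EReal.coe_lt_coe_iff.2 (by linarith)
    induction r with
    | bot => exact absurd rfl hr
    | top => exact ⟨l - 1, b, t - 2 * (l - 1) + b + 1, hl1, hb, EReal.coe_lt_top _, by linarith⟩
    | coe r =>
      have hr1 : ((r - 1 : ℝ) : EReal) < r := EReal.coe_lt_coe_iff.2 (by linarith)
      induction u with
      | top => exact absurd rfl hu
      | bot =>
        exact ⟨l - 1, 2 * (l - 1) + (r - 1) - t - 1, r - 1, hl1, EReal.bot_lt_coe _, hr1,
          by linarith⟩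
      | coe u =>
        have h' : t < 2 * l - u + r := by exact_mod_cast h
        refine ⟨l - (2 * l - u + r - t) / 8, u + (2 * l - u + r - t) / 8,
          r - (2 * l - u + r - t) / 8, ?_, ?_, ?_, by linarith⟩ <;>
        exact EReal.coe_lt_coe_iff.2 (by linarith)

end Parameters

end RevNet

theorem theorem2p3
    (μ : MeasureTheory.Measure (RevNet.RootedNetwork Unit)) [MeasureTheory.IsProbabilityMeasure μ]
    (hrev : RevNet.IsReversible μ)
    (hconn : ∀ᵐ N ∂μ, N.PosConnected)
    (hint : ∫⁻ N, (N.condAt N.root)⁻¹ ∂μ < ∞)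
    (δ : ℝ) (hδ : 0 < δ) (s : ℝ) (hs : (s : EReal) ≤ RevNet.dStar μ - (δ : EReal)) :
    ∃ ν : MeasureTheory.Measure (RevNet.RootedNetwork ℝ≥0),
      ν.map RevNet.RootedNetwork.forget = μ ∧
      RevNet.IsReversible ν ∧
      ∫⁻ q, (q.1.mark s(q.2.1, q.2.2) : ℝ≥0∞) ^ 2 ∂(RevNet.stepLaw ν) < ∞ ∧
      ∀ᵐ N ∂ν, ∀ᶠ R : ℕ in Filter.atTop,
        ENNReal.ofReal ((R : ℝ) ^ (s / 2)) ≤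
          N.weightDist N.root (N.ballCompl N.root R) := by
  have hs' : (s : EReal) < RevNet.dStar μ := by
    generalize RevNet.dStar μ = d at hs
    induction d with
    | bot =>
      rw [EReal.bot_sub, le_bot_iff] at hs
      exact absurd hs (EReal.coe_ne_bot s)
    | top => exact EReal.coe_lt_top s
    | coe d =>
      have : s ≤ d - δ := by exact_mod_cast hs
      exact EReal.coe_lt_coe_iff.2 (by linarith)
  obtain ⟨a₀, b₀, z₀, ha₀, hb₀, hz₀, hlt₀⟩ := RevNet.exists_real_lt_of_lt hs'
  obtain ⟨-, ⟨a, rfl, ha⟩, haa⟩ := lt_sSup_iff.1 ha₀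
  obtain ⟨-, ⟨b, rfl, hb⟩, hbb⟩ := sInf_lt_iff.1 hb₀
  obtain ⟨-, ⟨z, rfl, hz⟩, hzz⟩ := lt_sSup_iff.1 hz₀
  rw [EReal.coe_lt_coe_iff] at haa hbb hzz
  set g : ℝ := 2 * a - b + z - s with hg
  have hg0 : 0 < g := by rw [hg]; linarith
  -- The stretching uses 2 · g/4 of the gap g. The errors from η sum to 4η + 4ηa - 4η², at most
  -- 4η(1+|a|), which must fit into the remaining g/2.
  set η : ℝ := min (1 / 4) (g / (8 * (1 + |a|))) with hη
  have hη0 : 0 < η := lt_min (by norm_num) (by positivity)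
  have hη1 : η ≤ 1 / 4 := min_le_left _ _
  have hη2 : 8 * η * (1 + |a|) ≤ g := by
    have h1 : η ≤ g / (8 * (1 + |a|)) := min_le_right _ _
    rw [le_div_iff₀ (by positivity)] at h1
    linarith
  have hexp : 2 * (g / 4) + s + b + 2 * η - z - 2 * (1 - 2 * η) * (a - η) ≤ 0 := by
    have h1 : η * a ≤ η * |a| := mul_le_mul_of_nonneg_left (le_abs_self a) hη0.le
    nlinarith [sq_nonneg η]
  refine hrev.exists_edgeWeight hconn (RevNet.naturalDist_multiDist
    (ι := Σ n : ℕ, Fin ⌊η * n / 2⌋₊) (S := fun i => RevNet.dyadicScale η a b z i.1)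
    (r := fun i => 2 ^ (i.2 : ℕ) * (RevNet.dyadicScale η a b z i.1).t)
    (α := fun i => RevNet.scaleWeight (g / 4) i.1)
    (β := fun i => RevNet.scaleFactor (g / 4) s (2 * (|b| + η + 1) / η) i.1)) ?_ ?_
  · refine hrev.lintegral_sq_multiDist_lt hconn (fun i => ENNReal.ofReal_ne_top)
      (fun i => RevNet.dyadicScale_q_le hη0.le i.1) (fun i => ?_) (fun i => ?_) (fun i => ?_)
      (RevNet.tsum_scaleWeight_ne_top (by positivity) fun n => ?_)
      (ENNReal.mul_ne_top ENNReal.ofNat_ne_top ENNReal.ofReal_ne_top)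
      fun i => RevNet.scaleFactor_sq_mul_le (by linarith) hexp i.1
    · exact Nat.le_mul_of_pos_left _ (by positivity)
    · exact (RevNet.dyadicScale_pow_mul_t_le hη0.le (by linarith) i.2.2.le).trans
        (RevNet.dyadicScale_q_le hη0.le i.1)
    -- At n = 0 no radius is available, so only scales with 2^n ≥ 2 occur.
    · obtain ⟨n, j⟩ := i
      cases n with
      | zero => exact absurd j.2 (by simp)
      | succ n => exact Nat.le_self_pow n.succ_ne_zero 2
    · refine Nat.floor_le_of_le ?_
      have : (0 : ℝ) ≤ n := Nat.cast_nonneg n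
      nlinarith
  · filter_upwards [hrev.condAt_root_pos, ha η hη0, hb η hη0, hz η hη0] with N hN h1 h2 h3
    filter_upwards [RevNet.eventually_le_multiDist (s := s) (ε := g / 4) hη0 (by linarith)
      (RevNet.eventually_good hN hη0.le (by linarith) h1 h2 h3) hN] with R hR y _ hy
    exact hR y hy
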